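/- Let $V$ be a finite set and let $f,g:2^V\to\mathbb{R}_{\ge 0}$ be monotone set functions with $f(\emptyset)=g(\emptyset)=0$, where $f$ is supermodular, $g$ is submodular and strictly monotone, and $f(V)=g(V)=1$. For a set function $h$ write $h(S\mid A)=h(S\cup A)-h(A)$; for a permutation $\sigma$ of $V$ let $h^\sigma\in\mathbb{R}^V$ be given by $h^\sigma(u)=h(\{u\}\mid\{w: w\prec_\sigma u\})$, and let $h_{\min}=\min_{\sigma,u}h^\sigma(u)$. Let $\mathcal{B}_f=\{x\in\mathbb{R}^V_{\ge0}: x(V)=f(V),\ x(S)\ge f(S)\ \forall S\subseteq V\}$ and $\mathcal{B}_g=\{y\in\mathbb{R}^V_{\ge0}: y(V)=g(V),\ y(S)\le g(S)\ \forall S\subseteq V\}$. Let $\rho^*\in\mathbb{R}^V$ be the density vector of the density decomposition of $(V;f,g)$: as long as the union $A$ of the parts found so far is not $V$, the next part $S$ is an inclusion-maximal maximizer of $f(S\mid A)/g(S\mid A)$ over non-empty $S\subseteq V\setminus A$, and $\rho^*_u=f(S\mid A)/g(S\mid A)$ for every $u\in S$. Consider the following iteration. Start with $(x^{(0)},y^{(0)})=(f^{\sigma_0},g^{\sigma_0})$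 for an arbitrary permutation $\sigma_0$. For $k=0,1,\dots,T-1$, let $\sigma_{k+1}$ be a permutation that lists the elements $u\in V$ in non-increasing order of the current densities $\rho^{(k)}_u=x^{(k)}_u/y^{(k)}_u$ (ties broken arbitrarily), and set $$(x^{(k+1)},y^{(k+1)})=(1-\gamma_k)(x^{(k)},y^{(k)})+\gamma_k\,(f^{\sigma_{k+1}},g^{\sigma_{k+1}}),\qquad \gamma_k=\frac{2}{k+2}.$$ There is a universal constant $C>0$ such that for every such instance, every $T\ge 0$ and every such run, $(x^{(T)},y^{(T)})\in\mathcal{B}_f\times\mathcal{B}_g$ and the following hold. (1) For $\theta(t)=t^2$, the iteration is Frank--Wolfe for the convex program of minimizing $\Phi_\theta(x,y)=\sum_{u\in V}y_u\,\theta(x_u/y_u)$ over $\mathcal{B}_f\times\mathcal{B}_g$; that is, at each step $k<T$ the function $\Phi_\theta$ is differentiable at $(x^{(k)},y^{(k)})$ and $(f^{\sigma_{k+1}},g^{\sigma_{k+1}})$ is a point of $\mathcal{B}_f\times\mathcal{B}_g$ that minimizes $s\mapsto\langle s,\nabla\Phi_\theta(x^{(k)},y^{(k)})\rangle$ over $\mathcal{B}_f\times\mathcal{B}_g$.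 Moreover $$\|\rho^{(T)}-\rho^*\|_2\le\frac{C}{g_{\min}^{2.5}\sqrt{T+2}},$$ and if $f_{\min}>0$, then for all $u\in V$, $\rho^*_u>0$ and $$\left|\frac{\rho^{(T)}_u-\rho^*_u}{\rho^*_u}\right|\le\frac{C}{f_{\min}\,g_{\min}^{2.5}\sqrt{T+2}}.$$ (2) If $f_{\min}>0$, then for $\theta(t)=t\log t$ the iteration is Frank--Wolfe for $\Phi_\theta$ in the same sense, and for all $u\in V$ $$\|\rho^{(T)}-\rho^*\|_2\le\frac{1}{f_{\min}^{0.5}\,g_{\min}}\Big(\frac1{g_{\min}^2}+\frac1{f_{\min}}\Big)^{0.5}\frac{C}{\sqrt{T+2}},\qquad \left|\frac{\rho^{(T)}_u-\rho^*_u}{\rho^*_u}\right|\le\frac{1}{f_{\min}^{1.5}\,g_{\min}}\Big(\frac1{g_{\min}^2}+\frac1{f_{\min}}\Big)^{0.5}\frac{C}{\sqrt{T+2}}.$$ (3) If $f_{\min}>0$, then for $\theta(t)=-\log t$ the iteration is Frank--Wolfe for $\Phi_\theta$ in the same sense, and for all $u\in V$ $$\|\rho^{(T)}-\rho^*\|_2\le\frac{1}{g_{\min}^{1.5}}\Big(\frac1{g_{\min}}+\frac1{f_{\min}^2}\Big)^{0.5}\frac{C}{\sqrt{T+2}},\qquad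 \left|\frac{\rho^{(T)}_u-\rho^*_u}{\rho^*_u}\right|\le\frac{1}{f_{\min}\,g_{\min}^{1.5}}\Big(\frac1{g_{\min}}+\frac1{f_{\min}^2}\Big)^{0.5}\frac{C}{\sqrt{T+2}}.$$ -/

import Mathlib

open Finset

namespace DualModular

/-- A dual-modular instance `(V; f, g)`: non-negative monotone set functions vanishing at the empty
set, `f` supermodular and `g` submodular. -/
structure IsInstance {V : Type*} [DecidableEq V] (f g : Finset V → ℝ) : Prop where
  f_nonneg : ∀ A, 0 ≤ f A
  g_nonneg : ∀ A, 0 ≤ g A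
  f_empty : f ∅ = 0
  g_empty : g ∅ = 0
  f_mono : Monotone f
  g_mono : Monotone g
  f_supermodular : ∀ A B : Finset V, f A + f B ≤ f (A ∩ B) + f (A ∪ B)
  g_submodular : ∀ A B : Finset V, g (A ∩ B) + g (A ∪ B) ≤ g A + g B

/-- The marginal contribution `h(S | A) = h(S ∪ A) - h(A)`. -/
def marginal {V : Type*} [DecidableEq V] (h : Finset V → ℝ) (S A : Finset V) : ℝ :=
  h (S ∪ A) - h A

/-- The marginal density `ρ(S | A) = f(S | A) / g(S | A)`. -/
noncomputable def density {V : Type*} [DecidableEq V] (f g : Finset V → ℝ) (S A : Finset V) : ℝ :=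
  marginal f S A / marginal g S A

/-- `S` is a densest (non-empty) subset of the ground set `V \ A` for the marginal functions
`f(· | A)` and `g(· | A)`. -/
def IsDensest {V : Type*} [DecidableEq V] (f g : Finset V → ℝ) (A S : Finset V) : Prop :=
  S.Nonempty ∧ Disjoint S A ∧
    ∀ S' : Finset V, S'.Nonempty → Disjoint S' A → density f g S' A ≤ density f g S A

/-- The union `S 0 ∪ ⋯ ∪ S (i - 1)` of the parts before the `i`-th one. -/
def before {V : Type*} [DecidableEq V] (S : ℕ → Finset V) (i : ℕ) : Finset V :=
  (range i).biUnion S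

/-- `ρ` is the density vector of the density decomposition of `(V; f, g)`: there is a partition
`V = S 0 ∪ ⋯ ∪ S (k - 1)` in which every `S i` is an inclusion-maximal densest subset of what is
left after removing the earlier parts, and `ρ` takes on `S i` the marginal density of `S i`. -/
def IsDensityVector {V : Type*} [Fintype V] [DecidableEq V] (f g : Finset V → ℝ)
    (ρ : V → ℝ) : Prop :=
  ∃ (k : ℕ) (S : ℕ → Finset V),
    (∀ i < k, Maximal (IsDensest f g (before S i)) (S i)) ∧
    before S k = univ ∧
    ∀ i < k, ∀ u ∈ S i, ρ u = density f g (S i) (before S i)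

/-- A permutation of `V`, as the bijection that sends an element to its position;
`u` appears earlier than `v` when `σ u < σ v`. -/
abbrev Arrangement (V : Type*) [Fintype V] := V ≃ Fin (Fintype.card V)

/-- The vector `h^σ`: each `u` gets its marginal contribution given its predecessors in `σ`. -/
def permVec {V : Type*} [Fintype V] [DecidableEq V] (h : Finset V → ℝ) (σ : Arrangement V)
    (u : V) : ℝ :=
  marginal h {u} {w | σ w < σ u}

/-- `h_min`, the minimum of `h^σ(u)` over all permutations `σ` and elements `u`. -/
noncomputable def minMarginal {V : Type*} [Fintype V] [DecidableEq V] (h : Finset V → ℝ) : ℝ :=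
  ⨅ q : Arrangement V × V, permVec h q.1 q.2

/-- The base contrapolymatroid of `f`. -/
def baseGE {V : Type*} [Fintype V] (f : Finset V → ℝ) : Set (V → ℝ) :=
  {x | (∀ u, 0 ≤ x u) ∧ ∑ u, x u = f univ ∧ ∀ S : Finset V, f S ≤ ∑ u ∈ S, x u}

/-- The base polymatroid of `g`. -/
def baseLE {V : Type*} [Fintype V] (g : Finset V → ℝ) : Set (V → ℝ) :=
  {y | (∀ u, 0 ≤ y u) ∧ ∑ u, y u = g univ ∧ ∀ S : Finset V, ∑ u ∈ S, y u ≤ g S}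

/-- The feasible allocations, which form the domain of the convex program. -/
def feasible {V : Type*} [Fintype V] (f g : Finset V → ℝ) : Set ((V → ℝ) × (V → ℝ)) :=
  baseGE f ×ˢ baseLE g

/-- The objective `D_θ(x ‖ y) = ∑ u, y u * θ (x u / y u)` of the convex program. -/
noncomputable def objective {V : Type*} [Fintype V] (θ : ℝ → ℝ) (z : (V → ℝ) × (V → ℝ)) : ℝ :=
  ∑ u, z.2 u * θ (z.1 u / z.2 u)

/-- The Frank-Wolfe iterates `h^(k)` driven by the permutations `σ 0, σ 1, …`, with step size
`2 / (k + 2)`, started at `h^(σ 0)`. -/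
noncomputable def fwIter {V : Type*} [Fintype V] [DecidableEq V] (h : Finset V → ℝ)
    (σ : ℕ → Arrangement V) : ℕ → V → ℝ
  | 0 => permVec h (σ 0)
  | k + 1 => fun u =>
      (1 - 2 / ((k : ℝ) + 2)) * fwIter h σ k u + 2 / ((k : ℝ) + 2) * permVec h (σ (k + 1)) u

/-- The density vector `ρ^(k)` induced by the `k`-th allocation `(x^(k), y^(k))`. -/
noncomputable def iterDensity {V : Type*} [Fintype V] [DecidableEq V] (f g : Finset V → ℝ)
    (σ : ℕ → Arrangement V) (k : ℕ) (u : V) : ℝ :=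
  fwIter f σ k u / fwIter g σ k u

/-- `T` steps with the sorting oracle: `σ 0` is arbitrary, and for `k < T` the permutation
`σ (k + 1)` lists the elements in non-increasing order of the current density `ρ^(k)`
(ties are broken arbitrarily). -/
def IsSortedRun {V : Type*} [Fintype V] [DecidableEq V] (f g : Finset V → ℝ)
    (σ : ℕ → Arrangement V) (T : ℕ) : Prop :=
  ∀ k < T, ∀ u v : V, σ (k + 1) u < σ (k + 1) v → iterDensity f g σ k v ≤ iterDensity f g σ k u

/-- The first `T` steps driven by `σ` are Frank-Wolfe steps for the convex program with function
`θ`: the objective is differentiable at the current allocation, and the direction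
`(f^σ, g^σ)` minimizes the linearized objective over all feasible allocations. -/
def IsFrankWolfe {V : Type*} [Fintype V] [DecidableEq V] (θ : ℝ → ℝ) (f g : Finset V → ℝ)
    (σ : ℕ → Arrangement V) (T : ℕ) : Prop :=
  ∀ k < T, DifferentiableAt ℝ (objective θ) (fwIter f σ k, fwIter g σ k) ∧
    (permVec f (σ (k + 1)), permVec g (σ (k + 1))) ∈ feasible f g ∧
    ∀ s ∈ feasible f g,
      fderiv ℝ (objective θ) (fwIter f σ k, fwIter g σ k)
          (permVec f (σ (k + 1)), permVec g (σ (k + 1))) ≤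
        fderiv ℝ (objective θ) (fwIter f σ k, fwIter g σ k) s

/-- The Euclidean norm of `ρ^(T) - ρ`. -/
noncomputable def absError {V : Type*} [Fintype V] [DecidableEq V] (f g : Finset V → ℝ)
    (σ : ℕ → Arrangement V) (T : ℕ) (ρ : V → ℝ) : ℝ :=
  ‖WithLp.toLp 2 (iterDensity f g σ T - ρ)‖

/-- The multiplicative error `|(ρ^(T)_u - ρ_u) / ρ_u|` at the coordinate `u`. -/
noncomputable def relError {V : Type*} [Fintype V] [DecidableEq V] (f g : Finset V → ℝ)
    (σ : ℕ → Arrangement V) (T : ℕ) (ρ : V → ℝ) (u : V) : ℝ :=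
  |(iterDensity f g σ T u - ρ u) / ρ u|

end DualModular

open DualModular

namespace DualModular

/-! The partial derivatives of the objective at `(x, y)`, with `r = x / y`, are `θ' (r u)` in `x u`
and `θ (r u) - r u * θ' (r u)` in `y u`. For convex `θ` and `r ≥ 0` the first is non-decreasing and
the second non-increasing in `r u`. Hence one arrangement, sorted by non-increasing density, is
greedy-optimal for both base polytopes at once, and sorting is an exact Frank-Wolfe oracle for every
such `θ` (`linearized_permVec_le`).

No optimal allocation is constructed. The reference value is `opt = ∑ u, θ (ρ u) * permVec g τ u`,
where `τ` lists the blocks of the decomposition in order. Two inequalities tie it to the program.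
`IsBlockIndex.linearized_permVec_le`: the linearization at any iterate takes a value at most `opt`
at the oracle vertex, because inside a block no set is denser than the block itself.
`IsBlockIndex.sum_bregman_le`: the excess of a feasible value over `opt` is at least the weighted
Bregman divergence of the densities from `ρ`, because `τ` is greedy for the linearization at `ρ`.

The objective is homogeneous of degree one, so a step changes it by the linear gain plus exactly a
Bregman term. Bounding that term by `γ ^ 2` times a curvature constant gives the usual `O(1 / T)`
decay of the excess, and a quadratic lower bound on the divergence turns this into a bound on `∑
(ρ^(T) - ρ) ^ 2` (`IsBlockIndex.sum_sq_sub_le`). What depends on `θ` is the curvature, the size of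
the objective and the strong convexity of the divergence; for the two logarithmic functions the last
comes from comparison with the squared difference of square roots. -/

/-- A layer-cake inequality: if all superlevel sets of `c` have non-negative `w`-weight, then
`∑ c w ≥ m ∑ w` for every lower bound `m` of `c`. -/
theorem mul_sum_le_sum_mul_of_superlevel {V : Type*} (c w : V → ℝ) (S : Finset V) (m : ℝ)
    (hm : ∀ v ∈ S, m ≤ c v) (h : ∀ t, 0 ≤ ∑ v ∈ S with t < c v, w v) :
    m * ∑ v ∈ S, w v ≤ ∑ v ∈ S, c v * w v := by
  induction hn : #S using Nat.strong_induction_on generalizing S m with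
  | _ n ih =>
    rcases S.eq_empty_or_nonempty with rfl | hS
    · simp
    obtain ⟨v₀, hv₀, hmin⟩ := S.exists_min_image c hS
    have h0 : 0 ≤ ∑ v ∈ S, w v := by
      -- A threshold below the minimum makes the superlevel set all of `S`.
      have := h (c v₀ - 1)
      rwa [filter_true_of_mem (fun v hv => by linarith [hmin v hv])] at this
    have hlt : #{v ∈ S | c v₀ < c v} < n := by
      rw [← hn]
      exact card_lt_card (filter_ssubset.2 ⟨v₀, hv₀, lt_irrefl _⟩)
    -- The elements at the minimum contribute exactly `c v₀` times their weight; only strictly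
    -- larger values are left to the induction, with `c v₀` as the new lower bound.
    have key := ih _ hlt {v ∈ S | c v₀ < c v} (c v₀) (fun v hv => (mem_filter.1 hv).2.le)
      (fun t => by
        have := h (max t (c v₀))
        rw [filter_filter]
        convert this using 3
        rw [max_lt_iff, and_comm]) rfl
    have h1 := sum_filter_add_sum_filter_not S (fun v => c v₀ < c v) (fun v => c v * w v)
    have h2 := sum_filter_add_sum_filter_not S (fun v => c v₀ < c v) w
    have h3 : ∑ v ∈ S with ¬ c v₀ < c v, c v * w v = c v₀ * ∑ v ∈ S with ¬ c v₀ < c v, w v := by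
      rw [mul_sum]
      refine sum_congr rfl fun v hv => ?_
      obtain ⟨hv, hv'⟩ := mem_filter.1 hv
      rw [le_antisymm (not_lt.1 hv') (hmin v hv)]
    calc m * ∑ v ∈ S, w v ≤ c v₀ * ∑ v ∈ S, w v :=
          mul_le_mul_of_nonneg_right (hm v₀ hv₀) h0
      _ ≤ _ := by rw [← h1, ← h2, h3, mul_add]; linarith

theorem sum_mul_nonneg_of_superlevel {V : Type*} (c w : V → ℝ) (S : Finset V)
    (h0 : ∑ v ∈ S, w v = 0) (h : ∀ t, 0 ≤ ∑ v ∈ S with t < c v, w v) :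
    0 ≤ ∑ v ∈ S, c v * w v := by
  rcases S.eq_empty_or_nonempty with rfl | hS
  · simp
  obtain ⟨v₀, -, hmin⟩ := S.exists_min_image c hS
  simpa [h0] using mul_sum_le_sum_mul_of_superlevel c w S (c v₀) hmin h

theorem marginal_pos {V : Type*} [DecidableEq V] {g : Finset V → ℝ} (hg : StrictMono g)
    {S A : Finset V} (hS : S.Nonempty)
    (hd : Disjoint S A) : 0 < marginal g S A := by
  refine sub_pos.2 (hg (Finset.ssubset_iff_subset_ne.2 ⟨subset_union_right, fun he => ?_⟩))
  obtain ⟨u, hu⟩ := hS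
  exact disjoint_left.1 hd hu (he ▸ mem_union_left A hu)

theorem before_succ {V : Type*} [DecidableEq V] (S : ℕ → Finset V) (i : ℕ) :
    before S (i + 1) = S i ∪ before S i := by
  rw [before, range_add_one, biUnion_insert, before]

theorem exists_arrangement_of_injective {V α : Type*} [Fintype V] [LinearOrder α] (κ : V → α)
    (hκ : Function.Injective κ) : ∃ τ : Arrangement V, ∀ u v, τ u < τ v ↔ κ u < κ v := by
  let _ : LinearOrder V := LinearOrder.lift' κ hκ
  let e := Fintype.orderIsoFinOfCardEq V rfl
  exact ⟨e.symm.toEquiv, fun u v => e.symm.lt_iff_lt⟩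

/-- The arrangement lists the blocks one after the other. -/
def Respects {V : Type*} [Fintype V] (b : V → ℕ) (τ : Arrangement V) : Prop :=
  ∀ u v, b u < b v → τ u < τ v

theorem Respects.le {V : Type*} [Fintype V] {b : V → ℕ} {τ : Arrangement V} (h : Respects b τ)
    {u v : V}
    (huv : τ u < τ v) : b u ≤ b v :=
  not_lt.1 fun hlt => lt_asymm huv (h v u hlt)

theorem sum_le_sum_of_blocks {V : Type*} [Fintype V] (b : V → ℕ) {F G : V → ℝ}
    (h : ∀ u, ∑ v with b v = b u, F v ≤ ∑ v with b v = b u, G v) : ∑ u, F u ≤ ∑ u, G u := by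
  rw [← sum_fiberwise_of_maps_to (t := univ.image b) (fun u _ => mem_image_of_mem b (mem_univ u)) F,
    ← sum_fiberwise_of_maps_to (t := univ.image b) (fun u _ => mem_image_of_mem b (mem_univ u)) G]
  refine sum_le_sum fun i hi => ?_
  obtain ⟨u, -, rfl⟩ := mem_image.1 hi
  exact h u

/-- Sorting lexicographically by `(b u, σ u)` moves the blocks into order and keeps the order of `σ`
inside each block. -/
theorem exists_respects {V : Type*} [Fintype V] (b : V → ℕ) (σ : Arrangement V) :
    ∃ τ, Respects b τ ∧ ∀ u v, b u = b v → τ u < τ v → σ u < σ v := by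
  obtain ⟨τ, hτ⟩ := exists_arrangement_of_injective (fun u => toLex (b u, σ u))
    (fun u v h => σ.injective (Prod.ext_iff.1 (toLex.injective h)).2)
  refine ⟨τ, fun u v h => (hτ u v).2 (Prod.Lex.toLex_lt_toLex.2 (Or.inl h)), fun u v he h => ?_⟩
  rcases Prod.Lex.toLex_lt_toLex.1 ((hτ u v).1 h) with h' | h'
  · exact absurd he h'.ne
  · exact h'.2

theorem sum_eq_sum_of_blocks {V : Type*} [Fintype V] (b : V → ℕ) {F G : V → ℝ}
    (h : ∀ u, ∑ v with b v = b u, F v = ∑ v with b v = b u, G v) : ∑ u, F u = ∑ u, G u :=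
  le_antisymm (sum_le_sum_of_blocks b fun u => (h u).le)
    (sum_le_sum_of_blocks b fun u => (h u).ge)

/-! ### Greedy vertices of the base polytopes -/

section

variable {V : Type*} [Fintype V] [DecidableEq V]

/-- A set that contains with each element all its predecessors in the arrangement. -/
def IsPrefix (σ : Arrangement V) (P : Finset V) : Prop :=
  ∀ u ∈ P, ∀ v, σ v < σ u → v ∈ P

/-- The marginals telescope along the arrangement; the last element of a prefix has the rest of the
prefix as its predecessors. -/
theorem sum_permVec_of_isPrefix {h : Finset V → ℝ} (h0 : h ∅ = 0) (σ : Arrangement V)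
    {P : Finset V} (hP : IsPrefix σ P) : ∑ u ∈ P, permVec h σ u = h P := by
  induction P using Finset.induction_on_max_value σ with
  | empty => simp [h0]
  | insert u S hu hmax ih =>
    have hpred : ({w | σ w < σ u} : Finset V) = S := by
      ext w
      simp only [mem_filter, mem_univ, true_and]
      constructor
      · intro hw
        rcases mem_insert.1 (hP u (mem_insert_self u S) w hw) with rfl | hw'
        · exact absurd hw (lt_irrefl _)
        · exact hw'
      · intro hw
        refine lt_of_le_of_ne (hmax w hw) fun he => hu ?_
        rwa [← σ.injective he]
    rw [sum_insert hu, ih, permVec, marginal, hpred, insert_eq]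
    · ring
    · intro a ha v hv
      rcases mem_insert.1 (hP a (mem_insert_of_mem ha) v hv) with rfl | hw'
      · exact absurd hv (not_lt.2 (hmax a ha))
      · exact hw'

theorem sum_permVec {h : Finset V → ℝ} (h0 : h ∅ = 0) (σ : Arrangement V) :
    ∑ u, permVec h σ u = h univ :=
  sum_permVec_of_isPrefix h0 σ fun _ _ _ _ => mem_univ _

theorem permVec_nonneg {h : Finset V → ℝ} (hm : Monotone h) (σ : Arrangement V) (u : V) :
    0 ≤ permVec h σ u :=
  sub_nonneg.2 (hm subset_union_right)

/-- Remove the element `u` of `S` that comes last in `σ`: the rest lies among the predecessors of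
`u`, so by supermodularity the marginal of `u` over the rest is at most its marginal over all
predecessors. -/
theorem permVec_mem_baseGE {f : Finset V → ℝ} (h0 : f ∅ = 0) (hm : Monotone f)
    (hs : ∀ A B : Finset V, f A + f B ≤ f (A ∩ B) + f (A ∪ B)) (σ : Arrangement V) :
    permVec f σ ∈ baseGE f := by
  refine ⟨permVec_nonneg hm σ, sum_permVec h0 σ, fun S => ?_⟩
  induction S using Finset.induction_on_max_value σ with
  | empty => simp [h0]
  | insert u S hu hmax ih =>
    have hS : S ⊆ ({w | σ w < σ u} : Finset V) := fun w hw => by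
      refine mem_filter.2 ⟨mem_univ _, lt_of_le_of_ne (hmax w hw) fun he => hu ?_⟩
      rwa [← σ.injective he]
    have h1 : insert u S ∩ ({w | σ w < σ u} : Finset V) = S := by
      rw [insert_inter_of_notMem (by simp), inter_eq_left.2 hS]
    have h2 : insert u S ∪ ({w | σ w < σ u} : Finset V) = {u} ∪ ({w | σ w < σ u} : Finset V) := by
      rw [insert_eq, union_assoc, union_eq_right.2 hS]
    have := hs (insert u S) ({w | σ w < σ u} : Finset V)
    rw [h1, h2] at this
    rw [sum_insert hu, permVec, marginal]
    linarith

theorem permVec_mem_baseLE {g : Finset V → ℝ} (h0 : g ∅ = 0) (hm : Monotone g)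
    (hs : ∀ A B : Finset V, g (A ∩ B) + g (A ∪ B) ≤ g A + g B) (σ : Arrangement V) :
    permVec g σ ∈ baseLE g := by
  refine ⟨permVec_nonneg hm σ, sum_permVec h0 σ, fun S => ?_⟩
  induction S using Finset.induction_on_max_value σ with
  | empty => simp [h0]
  | insert u S hu hmax ih =>
    have hS : S ⊆ ({w | σ w < σ u} : Finset V) := fun w hw => by
      refine mem_filter.2 ⟨mem_univ _, lt_of_le_of_ne (hmax w hw) fun he => hu ?_⟩
      rwa [← σ.injective he]
    have h1 : insert u S ∩ ({w | σ w < σ u} : Finset V) = S := by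
      rw [insert_inter_of_notMem (by simp), inter_eq_left.2 hS]
    have h2 : insert u S ∪ ({w | σ w < σ u} : Finset V) = {u} ∪ ({w | σ w < σ u} : Finset V) := by
      rw [insert_eq, union_assoc, union_eq_right.2 hS]
    have := hs (insert u S) ({w | σ w < σ u} : Finset V)
    rw [h1, h2] at this
    rw [sum_insert hu, permVec, marginal]
    linarith

theorem permVec_mem_feasible {f g : Finset V → ℝ} (I : IsInstance f g) (σ : Arrangement V) :
    (permVec f σ, permVec g σ) ∈ feasible f g :=
  ⟨permVec_mem_baseGE I.f_empty I.f_mono I.f_supermodular σ,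
    permVec_mem_baseLE I.g_empty I.g_mono I.g_submodular σ⟩

/-- An arrangement that lists the elements in non-increasing order of `c` minimizes the linear
functional `c` over the base contrapolymatroid. -/
theorem sum_mul_permVec_le_of_mem_baseGE {f : Finset V → ℝ} (h0 : f ∅ = 0) {σ : Arrangement V}
    {c : V → ℝ} (hc : ∀ u v, σ u < σ v → c v ≤ c u) {x : V → ℝ} (hx : x ∈ baseGE f) :
    ∑ u, c u * permVec f σ u ≤ ∑ u, c u * x u := by
  -- Superlevel sets of `c` are prefixes of `σ`, where the vertex attains the constraint of the
  -- polytope with equality.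
  have := sum_mul_nonneg_of_superlevel c (fun u => x u - permVec f σ u) univ
    (by rw [sum_sub_distrib, hx.2.1, sum_permVec h0, sub_self]) (fun t => by
      rw [sum_sub_distrib, sum_permVec_of_isPrefix h0, sub_nonneg]
      · exact hx.2.2 _
      · intro u hu v hv
        simp only [mem_filter, mem_univ, true_and] at hu ⊢
        exact hu.trans_le (hc v u hv))
  simp only [mul_sub, sum_sub_distrib] at this
  linarith

/-- An arrangement that lists the elements in non-decreasing order of `d` minimizes the linear
functional `d` over the base polymatroid. -/
theorem sum_mul_permVec_le_of_mem_baseLE {g : Finset V → ℝ} (h0 : g ∅ = 0) {σ : Arrangement V}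
    {d : V → ℝ} (hd : ∀ u v, σ u < σ v → d u ≤ d v) {y : V → ℝ} (hy : y ∈ baseLE g) :
    ∑ u, d u * permVec g σ u ≤ ∑ u, d u * y u := by
  have := sum_mul_nonneg_of_superlevel (fun u => -d u) (fun u => permVec g σ u - y u) univ
    (by rw [sum_sub_distrib, hy.2.1, sum_permVec h0, sub_self]) (fun t => by
      rw [sum_sub_distrib, sum_permVec_of_isPrefix h0, sub_nonneg]
      · exact hy.2.2 _
      · intro u hu v hv
        simp only [mem_filter, mem_univ, true_and] at hu ⊢
        exact hu.trans_le (neg_le_neg (hd v u hv)))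
  simp only [mul_sub, sum_sub_distrib, neg_mul, sum_neg_distrib] at this
  linarith

theorem minMarginal_le_permVec (h : Finset V → ℝ) (σ : Arrangement V) (u : V) :
    minMarginal h ≤ permVec h σ u :=
  ciInf_le (Set.finite_range fun q : Arrangement V × V => permVec h q.1 q.2).bddBelow (σ, u)

theorem minMarginal_pos [Nonempty V] {g : Finset V → ℝ} (hg : StrictMono g) :
    0 < minMarginal g := by
  have : Nonempty (Arrangement V) := ⟨Fintype.equivFin V⟩
  obtain ⟨q, hq⟩ := exists_eq_ciInf_of_finite (f := fun q : Arrangement V × V => permVec g q.1 q.2)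
  rw [minMarginal, ← hq]
  exact marginal_pos hg (singleton_nonempty _) (by simp)

/-! ### Blocks of the density decomposition -/

/-- The blocks of a density decomposition, recorded by the index `b u` of the block that
contains `u`. -/
structure IsBlockIndex (f g : Finset V → ℝ) (ρ : V → ℝ) (b : V → ℕ) : Prop where
  anti : ∀ u v, b u ≤ b v → ρ v ≤ ρ u
  marginal_eq : ∀ u, marginal f {v | b v = b u} {v | b v < b u} =
    ρ u * marginal g {v | b v = b u} {v | b v < b u}
  marginal_le : ∀ u, ∀ Q ⊆ ({v | b v = b u} : Finset V),
    marginal f Q {v | b v < b u} ≤ ρ u * marginal g Q {v | b v < b u}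

theorem exists_isBlockIndex {f g : Finset V → ℝ} (hg : StrictMono g) {ρ : V → ℝ}
    (hρ : IsDensityVector f g ρ) : ∃ b, IsBlockIndex f g ρ b := by
  obtain ⟨k, S, hmax, huniv, hval⟩ := hρ
  have hex : ∀ u, ∃ i < k, u ∈ S i := fun u => by
    have : u ∈ before S k := huniv ▸ mem_univ u
    simpa [before] using this
  choose b hbk hbS using hex
  have hsub : ∀ {i j}, i < j → S i ⊆ before S j := fun {i j} hij v hv =>
    mem_biUnion.2 ⟨i, mem_range.2 hij, hv⟩
  have huniq : ∀ u i, i < k → u ∈ S i → b u = i := by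
    intro u i hi hu
    rcases lt_trichotomy (b u) i with h | h | h
    · exact absurd (hsub h (hbS u)) (disjoint_left.1 (hmax i hi).1.2.1 hu)
    · exact h
    · exact absurd (hsub h hu) (disjoint_left.1 (hmax (b u) (hbk u)).1.2.1 (hbS u))
  have hSb : ∀ i < k, ({v | b v = i} : Finset V) = S i := fun i hi => by
    ext v
    simp only [mem_filter, mem_univ, true_and]
    exact ⟨fun h => h ▸ hbS v, huniq v i hi⟩
  have hAb : ∀ i ≤ k, ({v | b v < i} : Finset V) = before S i := fun i hi => by
    ext v
    simp only [mem_filter, mem_univ, true_and, before, mem_biUnion, mem_range]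
    exact ⟨fun h => ⟨b v, h, hbS v⟩, fun ⟨j, hj, hv⟩ => huniq v j (hj.trans_le hi) hv ▸ hj⟩
  have heq : ∀ i < k, marginal f (S i) (before S i) =
      density f g (S i) (before S i) * marginal g (S i) (before S i) := fun i hi => by
    rw [density, div_mul_cancel₀ _ (marginal_pos hg (hmax i hi).1.1 (hmax i hi).1.2.1).ne']
  have hle : ∀ i < k, ∀ Q : Finset V, Disjoint Q (before S i) → marginal f Q (before S i) ≤
      density f g (S i) (before S i) * marginal g Q (before S i) := by
    intro i hi Q hQ
    rcases Q.eq_empty_or_nonempty with rfl | hne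
    · simp [marginal]
    · have := (hmax i hi).1.2.2 Q hne hQ
      rwa [density, div_le_iff₀ (marginal_pos hg hne hQ)] at this
  -- Densities do not increase: otherwise `S (i + 1) ∪ S i` would be denser than `S i` over `before
  -- S i`.
  have hstep : ∀ i, i + 1 < k → density f g (S (i + 1)) (before S (i + 1)) ≤
      density f g (S i) (before S i) := by
    intro i hi
    have h1 := heq i (by omega)
    have h2 := heq (i + 1) hi
    have hd := (hmax (i + 1) hi).1.2.1
    have hp := marginal_pos hg (hmax (i + 1) hi).1.1 hd
    rw [before_succ] at hd
    have h3 := hle i (by omega) (S (i + 1) ∪ S i)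
      (disjoint_union_left.2 ⟨(disjoint_union_right.1 hd).2, (hmax i (by omega)).1.2.1⟩)
    refine le_of_mul_le_mul_right ?_ hp
    rw [← h2]
    simp only [marginal, before_succ, union_assoc] at h1 h2 h3 ⊢
    linarith
  have hanti : ∀ i j, i ≤ j → j < k → density f g (S j) (before S j) ≤
      density f g (S i) (before S i) := by
    intro i j hij
    induction j, hij using Nat.le_induction with
    | base => exact fun _ => le_rfl
    | succ j _ ih => exact fun hj => (hstep j hj).trans (ih (by omega))
  have hρb : ∀ u, ρ u = density f g (S (b u)) (before S (b u)) := fun u =>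
    hval (b u) (hbk u) u (hbS u)
  refine ⟨b, fun u v huv => ?_, fun u => ?_, fun u Q hQ => ?_⟩
  · rw [hρb, hρb]
    exact hanti _ _ huv (hbk v)
  · rw [hSb _ (hbk u), hAb _ (hbk u).le, hρb, heq _ (hbk u)]
  · rw [hAb _ (hbk u).le, hρb]
    rw [hSb _ (hbk u)] at hQ
    exact hle _ (hbk u) Q (disjoint_of_subset_left hQ (hmax _ (hbk u)).1.2.1)

/-- Both the union of the earlier blocks and its union with `Q` are prefixes, and the sum is the
difference of the two prefix values. -/
theorem Respects.sum_permVec_eq_marginal {h : Finset V → ℝ} (h0 : h ∅ = 0) {b : V → ℕ}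
    {τ : Arrangement V} (hτ : Respects b τ) {i : ℕ} {Q : Finset V}
    (hQ : Q ⊆ ({v | b v = i} : Finset V))
    (hQ' : ∀ u ∈ Q, ∀ v, b v = i → τ v < τ u → v ∈ Q) :
    ∑ u ∈ Q, permVec h τ u = marginal h Q {v | b v < i} := by
  have hQi : ∀ u ∈ Q, b u = i := fun u hu => by simpa using hQ hu
  have hA : IsPrefix τ ({v | b v < i} : Finset V) := fun u hu v hv => by
    simp only [mem_filter, mem_univ, true_and] at hu ⊢
    exact (hτ.le hv).trans_lt hu
  have hQA : IsPrefix τ (Q ∪ ({v | b v < i} : Finset V)) := fun u hu v hv => by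
    rcases mem_union.1 hu with hu | hu
    · rcases ((hτ.le hv).trans_eq (hQi u hu)).lt_or_eq with h | h
      · exact mem_union_right _ (by simpa using h)
      · exact mem_union_left _ (hQ' u hu v h hv)
    · exact mem_union_right _ (hA u hu v hv)
  have hd : Disjoint Q ({v | b v < i} : Finset V) := disjoint_left.2 fun u hu hu' => by
    simp [hQi u hu] at hu'
  rw [marginal, ← sum_permVec_of_isPrefix h0 τ hQA, ← sum_permVec_of_isPrefix h0 τ hA,
    sum_union hd, add_sub_cancel_right]

theorem Respects.sum_block {h : Finset V → ℝ} (h0 : h ∅ = 0) {b : V → ℕ}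
    {τ : Arrangement V} (hτ : Respects b τ) (i : ℕ) :
    ∑ u with b u = i, permVec h τ u = marginal h {v | b v = i} {v | b v < i} :=
  hτ.sum_permVec_eq_marginal h0 Subset.rfl fun u _ v hv _ => by simpa using hv

namespace IsBlockIndex

variable {f g : Finset V → ℝ} {ρ : V → ℝ} {b : V → ℕ}

theorem eq_of_eq (B : IsBlockIndex f g ρ b) {u v : V} (h : b u = b v) : ρ u = ρ v :=
  le_antisymm (B.anti v u h.ge) (B.anti u v h.le)

theorem sum_block_mul (B : IsBlockIndex f g ρ b) (φ : ℝ → ℝ) (w : V → ℝ) (u : V) :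
    ∑ v with b v = b u, φ (ρ v) * w v = φ (ρ u) * ∑ v with b v = b u, w v := by
  rw [mul_sum]
  refine sum_congr rfl fun v hv => ?_
  rw [B.eq_of_eq (mem_filter.1 hv).2]

theorem sum_mul_permVec_f (B : IsBlockIndex f g ρ b) (I : IsInstance f g) {τ : Arrangement V}
    (hτ : Respects b τ) (φ : ℝ → ℝ) :
    ∑ u, φ (ρ u) * permVec f τ u = ∑ u, φ (ρ u) * (ρ u * permVec g τ u) := by
  refine sum_eq_sum_of_blocks b fun u => ?_
  rw [B.sum_block_mul φ, B.sum_block_mul φ, B.sum_block_mul (fun t => t), hτ.sum_block I.f_empty,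
    hτ.sum_block I.g_empty, B.marginal_eq]

/-- This makes the reference value independent of the block-respecting arrangement used to define
it. -/
theorem sum_mul_permVec_g (B : IsBlockIndex f g ρ b) (I : IsInstance f g) {τ τ' : Arrangement V}
    (hτ : Respects b τ) (hτ' : Respects b τ') (φ : ℝ → ℝ) :
    ∑ u, φ (ρ u) * permVec g τ u = ∑ u, φ (ρ u) * permVec g τ' u := by
  refine sum_eq_sum_of_blocks b fun u => ?_
  rw [B.sum_block_mul φ, B.sum_block_mul φ, hτ.sum_block I.g_empty, hτ'.sum_block I.g_empty]

/-- Inside a block, superlevel sets of `c` are initial segments, and `marginal_le` bounds their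
`f`-marginal by the block density times their `g`-marginal. Equality holds on the whole block, so
the layer-cake inequality applies block by block. -/
theorem sum_mul_permVec_le (B : IsBlockIndex f g ρ b) (I : IsInstance f g) {τ : Arrangement V}
    (hτ : Respects b τ) {c : V → ℝ} (hc : ∀ u v, b u = b v → τ u < τ v → c v ≤ c u) :
    ∑ u, c u * permVec f τ u ≤ ∑ u, c u * (ρ u * permVec g τ u) := by
  refine sum_le_sum_of_blocks b fun u => ?_
  have hρ : ∀ Q ⊆ ({v | b v = b u} : Finset V),
      ∑ v ∈ Q, ρ v * permVec g τ v = ρ u * ∑ v ∈ Q, permVec g τ v := fun Q hQ => by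
    rw [mul_sum]
    exact sum_congr rfl fun v hv => by rw [B.eq_of_eq (mem_filter.1 (hQ hv)).2]
  have := sum_mul_nonneg_of_superlevel c (fun v => ρ v * permVec g τ v - permVec f τ v)
    {v | b v = b u}
    (by
      rw [sum_sub_distrib, hρ _ Subset.rfl, hτ.sum_block I.f_empty, hτ.sum_block I.g_empty,
        B.marginal_eq, sub_self])
    (fun t => by
      have hQ : ∀ w ∈ ({v ∈ ({v | b v = b u} : Finset V) | t < c v} : Finset V), ∀ v, b v = b u →
          τ v < τ w → v ∈ ({v ∈ ({v | b v = b u} : Finset V) | t < c v} : Finset V) := by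
        intro w hw v hv hlt
        simp only [mem_filter, mem_univ, true_and] at hw ⊢
        exact ⟨hv, hw.2.trans_le (hc v w (hv.trans hw.1.symm) hlt)⟩
      rw [sum_sub_distrib, hρ _ (filter_subset _ _),
        hτ.sum_permVec_eq_marginal I.f_empty (filter_subset _ _) hQ,
        hτ.sum_permVec_eq_marginal I.g_empty (filter_subset _ _) hQ, sub_nonneg]
      exact B.marginal_le u _ (filter_subset _ _))
  simp only [mul_sub, sum_sub_distrib] at this
  linarith

end IsBlockIndex
end

/-! ### Bregman divergence, gradient and the Frank-Wolfe recursion -/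

/-- The error of the first-order approximation of `θ` at `r`, evaluated at `s`. -/
def bregman (θ θ' : ℝ → ℝ) (s r : ℝ) : ℝ := θ s - θ r - θ' r * (s - r)

/-- `θ` is convex and differentiable on a set `D` of non-negative reals, with derivative `θ'`. -/
structure IsConvexDiff (θ θ' : ℝ → ℝ) (D : Set ℝ) : Prop where
  nonneg : ∀ r ∈ D, 0 ≤ r
  hasDerivAt : ∀ r ∈ D, HasDerivAt θ (θ' r) r
  mono : MonotoneOn θ' D
  bregman_nonneg : ∀ s ∈ D, ∀ r ∈ D, 0 ≤ bregman θ θ' s r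

/-- The quantity is the height at which the tangent at `r` meets the vertical axis; for a convex
function it falls as the point of tangency moves right on the non-negative axis. -/
theorem IsConvexDiff.anti {θ θ' : ℝ → ℝ} {D : Set ℝ} (H : IsConvexDiff θ θ' D) :
    AntitoneOn (fun r => θ r - r * θ' r) D := fun s hs r hr hsr => by
  have h1 := H.bregman_nonneg s hs r hr
  have h2 := mul_le_mul_of_nonneg_left (H.mono hs hr hsr) (H.nonneg s hs)
  simp only [bregman] at h1 ⊢
  linarith

theorem hasFDerivAt_objective {V : Type*} [Fintype V] {θ θ' : ℝ → ℝ} {x y : V → ℝ}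
    (hy : ∀ u, y u ≠ 0) (hθ : ∀ u, HasDerivAt θ (θ' (x u / y u)) (x u / y u)) :
    ∃ L : (V → ℝ) × (V → ℝ) →L[ℝ] ℝ, HasFDerivAt (objective θ) L (x, y) ∧
      ∀ s, L s = ∑ u, θ' (x u / y u) * s.1 u +
        ∑ u, (θ (x u / y u) - x u / y u * θ' (x u / y u)) * s.2 u := by
  have h1 : ∀ u : V, HasFDerivAt (fun z : (V → ℝ) × (V → ℝ) => z.1 u)
      ((ContinuousLinearMap.proj (R := ℝ) (φ := fun _ : V => ℝ) u).comp
        (ContinuousLinearMap.fst ℝ (V → ℝ) (V → ℝ))) (x, y) := fun u =>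
    ((ContinuousLinearMap.proj (R := ℝ) (φ := fun _ : V => ℝ) u).comp
        (ContinuousLinearMap.fst ℝ (V → ℝ) (V → ℝ))).hasFDerivAt
  have h2 : ∀ u : V, HasFDerivAt (fun z : (V → ℝ) × (V → ℝ) => z.2 u)
      ((ContinuousLinearMap.proj (R := ℝ) (φ := fun _ : V => ℝ) u).comp
        (ContinuousLinearMap.snd ℝ (V → ℝ) (V → ℝ))) (x, y) := fun u =>
    ((ContinuousLinearMap.proj (R := ℝ) (φ := fun _ : V => ℝ) u).comp
        (ContinuousLinearMap.snd ℝ (V → ℝ) (V → ℝ))).hasFDerivAt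
  have h3 := fun u : V => (h1 u).mul (((hasDerivAt_inv (hy u)).comp_hasFDerivAt (x, y) (h2 u)))
  have h4 := fun u : V => (h2 u).mul
    (HasDerivAt.comp_hasFDerivAt (f := fun z : (V → ℝ) × (V → ℝ) => z.1 u * (z.2 u)⁻¹) (x, y)
      (by simpa only [div_eq_mul_inv] using hθ u) (h3 u))
  refine ⟨_, HasFDerivAt.fun_sum fun u _ => h4 u, fun s => ?_⟩
  rw [← sum_add_distrib, _root_.sum_apply]
  refine sum_congr rfl fun u _ => ?_
  have := hy u
  simp [div_eq_mul_inv]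
  field_simp
  ring

/-- The standard Frank-Wolfe recursion. The first step has step size one and need not satisfy the
curvature estimate, since `M` bounds the values anyway. -/
theorem le_of_frankWolfe_recursion {h : ℕ → ℝ} {T : ℕ} {M : ℝ} (hM0 : 0 ≤ M)
    (hM : ∀ k ≤ T, h k ≤ M)
    (hstep : ∀ k, 1 ≤ k → k < T →
      h (k + 1) ≤ (1 - 2 / ((k : ℝ) + 2)) * h k + (2 / ((k : ℝ) + 2)) ^ 2 * M) :
    h T ≤ 4 * M / ((T : ℝ) + 2) := by
  suffices ∀ k ≤ T, h k ≤ 4 * M / ((k : ℝ) + 2) from this T le_rfl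
  intro k
  induction k with
  | zero => exact fun hk => (hM 0 hk).trans (by norm_num; linarith)
  | succ k ih =>
    intro hk
    rcases Nat.eq_zero_or_pos k with rfl | hpos
    · exact (hM _ hk).trans (by norm_num; linarith)
    · have hc : 0 ≤ 1 - 2 / ((k : ℝ) + 2) := by
        rw [sub_nonneg, div_le_one (by positivity)]
        linarith [Nat.cast_nonneg (α := ℝ) k]
      refine (hstep k hpos hk).trans
        ((add_le_add_left (mul_le_mul_of_nonneg_left (ih (by omega)) hc) _).trans ?_)
      have : (1 - 2 / ((k : ℝ) + 2)) * (4 * M / ((k : ℝ) + 2)) + (2 / ((k : ℝ) + 2)) ^ 2 * M =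
          4 * M * (((k : ℝ) + 1) / ((k : ℝ) + 2) ^ 2) := by
        field_simp
        ring
      rw [this]
      -- This is `(k + 1) * (k + 3) ≤ (k + 2) ^ 2`.
      have hfrac : ((k : ℝ) + 1) / ((k : ℝ) + 2) ^ 2 ≤ 1 / (((k + 1 : ℕ) : ℝ) + 2) := by
        push_cast
        rw [div_le_div_iff₀ (by positivity) (by positivity)]
        nlinarith
      exact (mul_le_mul_of_nonneg_left hfrac (by positivity)).trans_eq (by ring)

theorem stepSize_mem (k : ℕ) : 0 ≤ 2 / ((k : ℝ) + 2) ∧ 0 ≤ 1 - 2 / ((k : ℝ) + 2) := by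
  refine ⟨by positivity, ?_⟩
  rw [sub_nonneg, div_le_one (by positivity)]
  linarith [Nat.cast_nonneg (α := ℝ) k]

theorem le_one_of_sum_eq_one {V : Type*} [Fintype V] {x : V → ℝ} (h0 : ∀ u, 0 ≤ x u) (h1 : ∑ u, x u = 1) (u : V) :
    x u ≤ 1 :=
  h1 ▸ single_le_sum (fun v _ => h0 v) (mem_univ u)

theorem sum_sub_sq_le_two {V : Type*} [Fintype V] {x s : V → ℝ} (hx : ∀ u, 0 ≤ x u) (hx1 : ∑ u, x u = 1)
    (hs : ∀ u, 0 ≤ s u) (hs1 : ∑ u, s u = 1) : ∑ u, (s u - x u) ^ 2 ≤ 2 := by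
  calc ∑ u, (s u - x u) ^ 2 ≤ ∑ u, (s u + x u) := sum_le_sum fun u _ => by
        have h1 := le_one_of_sum_eq_one hx hx1 u
        have h2 := le_one_of_sum_eq_one hs hs1 u
        nlinarith [hx u, hs u, mul_nonneg (hx u) (hs u)]
    _ = 2 := by rw [sum_add_distrib, hx1, hs1]; norm_num

theorem marginal_le_univ {V : Type*} [Fintype V] [DecidableEq V] {h : Finset V → ℝ}
    (hm : Monotone h) (h0 : ∀ A, 0 ≤ h A) (S A : Finset V) : marginal h S A ≤ h univ :=
  (sub_le_self _ (h0 A)).trans (hm (subset_univ _))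

/-! ### Bounds on iterates and on the density vector -/

section

variable {V : Type*} [Fintype V] [DecidableEq V]

theorem minMarginal_le_fwIter (h : Finset V → ℝ) (σ : ℕ → Arrangement V) (k : ℕ) (u : V) :
    minMarginal h ≤ fwIter h σ k u := by
  induction k with
  | zero => exact minMarginal_le_permVec h _ u
  | succ k ih =>
    obtain ⟨h0, h1⟩ := stepSize_mem k
    have h2 := mul_le_mul_of_nonneg_left ih h1
    have h3 := mul_le_mul_of_nonneg_left (minMarginal_le_permVec h (σ (k + 1)) u) h0
    rw [fwIter]
    linarith

theorem fwIter_mem_baseGE {f g : Finset V → ℝ} (I : IsInstance f g) (σ : ℕ → Arrangement V)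
    (k : ℕ) : fwIter f σ k ∈ baseGE f := by
  induction k with
  | zero => exact (permVec_mem_feasible I (σ 0)).1
  | succ k ih =>
    obtain ⟨h0, h1⟩ := stepSize_mem k
    obtain ⟨ha, hb, hc⟩ := ih
    obtain ⟨ha', hb', hc'⟩ := (permVec_mem_feasible I (σ (k + 1))).1
    dsimp only at ha' hb' hc'
    refine ⟨fun u => add_nonneg (mul_nonneg h1 (ha u)) (mul_nonneg h0 (ha' u)), ?_, fun S => ?_⟩
    · simp only [fwIter, sum_add_distrib, ← mul_sum, hb, hb']
      ring
    · simp only [fwIter, sum_add_distrib, ← mul_sum]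
      have h2 := mul_le_mul_of_nonneg_left (hc S) h1
      have h3 := mul_le_mul_of_nonneg_left (hc' S) h0
      linarith

theorem fwIter_mem_baseLE {f g : Finset V → ℝ} (I : IsInstance f g) (σ : ℕ → Arrangement V)
    (k : ℕ) : fwIter g σ k ∈ baseLE g := by
  induction k with
  | zero => exact (permVec_mem_feasible I (σ 0)).2
  | succ k ih =>
    obtain ⟨h0, h1⟩ := stepSize_mem k
    obtain ⟨ha, hb, hc⟩ := ih
    obtain ⟨ha', hb', hc'⟩ := (permVec_mem_feasible I (σ (k + 1))).2
    dsimp only at ha' hb' hc'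
    refine ⟨fun u => add_nonneg (mul_nonneg h1 (ha u)) (mul_nonneg h0 (ha' u)), ?_, fun S => ?_⟩
    · simp only [fwIter, sum_add_distrib, ← mul_sum, hb, hb']
      ring
    · simp only [fwIter, sum_add_distrib, ← mul_sum]
      have h2 := mul_le_mul_of_nonneg_left (hc S) h1
      have h3 := mul_le_mul_of_nonneg_left (hc' S) h0
      linarith

namespace IsBlockIndex

variable {f g : Finset V → ℝ} {ρ : V → ℝ} {b : V → ℕ}

/-- The single marginal of `u` is at most the `f`-marginal of its block, which is `ρ u` times a
`g`-marginal of size at most one. -/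
theorem minMarginal_le (B : IsBlockIndex f g ρ b) (I : IsInstance f g) (hg : StrictMono g)
    (hg1 : g univ = 1) (u : V) : minMarginal f ≤ ρ u ∧ 0 ≤ ρ u := by
  obtain ⟨τ, hτ, -⟩ := exists_respects b (Fintype.equivFin V)
  have hu : u ∈ ({v | b v = b u} : Finset V) := by simp
  have hgp : 0 < marginal g {v | b v = b u} {v | b v < b u} :=
    marginal_pos hg ⟨u, hu⟩ (disjoint_left.2 fun v hv hv' => by
      simp only [mem_filter, mem_univ, true_and] at hv hv'
      omega)
  have hf := B.marginal_eq u
  have hf1 : permVec f τ u ≤ marginal f {v | b v = b u} {v | b v < b u} := by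
    rw [← hτ.sum_block I.f_empty]
    exact single_le_sum (fun v _ => permVec_nonneg I.f_mono τ v) hu
  have hgle : marginal g {v | b v = b u} {v | b v < b u} ≤ 1 :=
    (marginal_le_univ I.g_mono I.g_nonneg _ _).trans_eq hg1
  have h0 : 0 ≤ ρ u := by
    refine nonneg_of_mul_nonneg_left ?_ hgp
    rw [← hf]
    exact (permVec_nonneg I.f_mono τ u).trans hf1
  refine ⟨?_, h0⟩
  calc minMarginal f ≤ ρ u * marginal g {v | b v = b u} {v | b v < b u} :=
        (minMarginal_le_permVec f τ u).trans (hf1.trans hf.le)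
    _ ≤ ρ u * 1 := mul_le_mul_of_nonneg_left hgle h0
    _ = ρ u := mul_one _

theorem mul_minMarginal_le_one (B : IsBlockIndex f g ρ b) (I : IsInstance f g)
    (hg : StrictMono g) (hf1 : f univ = 1) (hg1 : g univ = 1) (u : V) :
    ρ u * minMarginal g ≤ 1 := by
  obtain ⟨τ, hτ, -⟩ := exists_respects b (Fintype.equivFin V)
  have hu : u ∈ ({v | b v = b u} : Finset V) := by simp
  have h1 : permVec g τ u ≤ marginal g {v | b v = b u} {v | b v < b u} := by
    rw [← hτ.sum_block I.g_empty]
    exact single_le_sum (fun v _ => permVec_nonneg I.g_mono τ v) hu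
  have h2 : marginal f {v | b v = b u} {v | b v < b u} ≤ 1 :=
    (marginal_le_univ I.f_mono I.f_nonneg _ _).trans_eq hf1
  have := mul_le_mul_of_nonneg_left ((minMarginal_le_permVec g τ u).trans h1)
    (B.minMarginal_le I hg hg1 u).2
  rw [← B.marginal_eq] at this
  linarith

end IsBlockIndex

/-! ### Convergence of a sorted run for a general convex function -/

section run

variable {f g : Finset V → ℝ} {ρ : V → ℝ} {b : V → ℕ} {θ θ' : ℝ → ℝ} {D : Set ℝ}

/-- An arrangement sorted by density minimizes the linearized objective. -/
theorem linearized_permVec_le (I : IsInstance f g) (H : IsConvexDiff θ θ' D) {r : V → ℝ}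
    (hr : ∀ u, r u ∈ D) {σ : Arrangement V} (hσ : ∀ u v, σ u < σ v → r v ≤ r u)
    {s : (V → ℝ) × (V → ℝ)} (hs : s ∈ feasible f g) :
    ∑ u, θ' (r u) * permVec f σ u + ∑ u, (θ (r u) - r u * θ' (r u)) * permVec g σ u ≤
      ∑ u, θ' (r u) * s.1 u + ∑ u, (θ (r u) - r u * θ' (r u)) * s.2 u :=
  add_le_add
    (sum_mul_permVec_le_of_mem_baseGE I.f_empty
      (fun u v h => H.mono (hr v) (hr u) (hσ u v h)) hs.1)
    (sum_mul_permVec_le_of_mem_baseLE I.g_empty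
      (fun u v h => H.anti (hr v) (hr u) (hσ u v h)) hs.2)

theorem isFrankWolfe_of_isSortedRun (I : IsInstance f g) (hg0 : 0 < minMarginal g)
    (H : IsConvexDiff θ θ' D) {σ : ℕ → Arrangement V} {T : ℕ} (hσ : IsSortedRun f g σ T)
    (hD : ∀ k u, iterDensity f g σ k u ∈ D) : IsFrankWolfe θ f g σ T := by
  intro k hk
  obtain ⟨L, hL, hL'⟩ := hasFDerivAt_objective (θ := θ) (θ' := θ') (x := fwIter f σ k)
    (y := fwIter g σ k) (fun u => (hg0.trans_le (minMarginal_le_fwIter g σ k u)).ne')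
    (fun u => H.hasDerivAt _ (hD k u))
  refine ⟨hL.differentiableAt, permVec_mem_feasible I _, fun s hs => ?_⟩
  rw [hL.fderiv, hL', hL']
  exact linearized_permVec_le I H (hD k) (hσ k hk) hs

/-- The value of the linearized objective at the Frank-Wolfe vertex is at most the value
of the density decomposition. -/
theorem IsBlockIndex.linearized_permVec_le (B : IsBlockIndex f g ρ b) (I : IsInstance f g)
    (H : IsConvexDiff θ θ' D) (hρ : ∀ u, ρ u ∈ D) {τ : Arrangement V} (hτ : Respects b τ)
    {r : V → ℝ} (hr : ∀ u, r u ∈ D) {σ : Arrangement V} (hσ : ∀ u v, σ u < σ v → r v ≤ r u) :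
    ∑ u, θ' (r u) * permVec f σ u + ∑ u, (θ (r u) - r u * θ' (r u)) * permVec g σ u ≤
      ∑ u, θ (ρ u) * permVec g τ u := by
  -- The competitor `π` respects the blocks and follows `σ` inside each, so `θ' (r u)` is
  -- non-increasing along every block.
  obtain ⟨π, hπ, hπσ⟩ := exists_respects b σ
  refine (DualModular.linearized_permVec_le I H hr hσ (permVec_mem_feasible I π)).trans ?_
  have h1 := B.sum_mul_permVec_le I hπ (c := fun u => θ' (r u))
    (fun u v he hlt => H.mono (hr v) (hr u) (hσ u v (hπσ u v he hlt)))
  rw [B.sum_mul_permVec_g I hτ hπ θ]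
  refine (add_le_add_left h1 _).trans ?_
  rw [← sum_add_distrib]
  refine sum_le_sum fun u _ => ?_
  -- The tangent to `θ` at `r u`, evaluated at `ρ u`, lies below `θ (ρ u)`.
  have h2 := mul_nonneg (H.bregman_nonneg _ (hρ u) _ (hr u)) (permVec_nonneg I.g_mono π u)
  simp only [bregman] at h2
  linarith

/-- The excess of a feasible value over the value of the density decomposition dominates the
Bregman divergence of the densities. -/
theorem IsBlockIndex.sum_bregman_le (B : IsBlockIndex f g ρ b) (I : IsInstance f g)
    (H : IsConvexDiff θ θ' D) (hρ : ∀ u, ρ u ∈ D) {τ : Arrangement V} (hτ : Respects b τ)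
    {z : (V → ℝ) × (V → ℝ)} (hz : z ∈ feasible f g) (hz0 : ∀ u, z.2 u ≠ 0) :
    ∑ u, z.2 u * bregman θ θ' (z.1 u / z.2 u) (ρ u) ≤
      objective θ z - ∑ u, θ (ρ u) * permVec g τ u := by
  have h1 := DualModular.linearized_permVec_le I H hρ (σ := τ)
    (fun u v h => B.anti u v (hτ.le h)) hz
  have h2 := B.sum_mul_permVec_f I hτ θ'
  rw [h2, ← sum_add_distrib, ← sum_add_distrib] at h1
  have h3 : ∑ u, z.2 u * bregman θ θ' (z.1 u / z.2 u) (ρ u) = objective θ z -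
      ∑ u, (θ' (ρ u) * z.1 u + (θ (ρ u) - ρ u * θ' (ρ u)) * z.2 u) := by
    rw [objective, ← sum_sub_distrib]
    refine sum_congr rfl fun u _ => ?_
    have := hz0 u
    simp only [bregman]
    field_simp
    ring
  have h4 : ∑ u, θ (ρ u) * permVec g τ u = ∑ u, (θ' (ρ u) * (ρ u * permVec g τ u) +
      (θ (ρ u) - ρ u * θ' (ρ u)) * permVec g τ u) :=
    sum_congr rfl fun u _ => by ring
  rw [h3, h4]
  linarith

/-- The rate of convergence of the densities, in terms of a bound `K` on the curvature and on the
objective, and of the strong convexity `κ` of the divergence. -/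
theorem IsBlockIndex.sum_sq_sub_le (B : IsBlockIndex f g ρ b) (I : IsInstance f g)
    (hf1 : f univ = 1) (hg1 : g univ = 1) (hg0 : 0 < minMarginal g)
    (H : IsConvexDiff θ θ' D) (hρ : ∀ u, ρ u ∈ D) {σ : ℕ → Arrangement V} {T : ℕ}
    (hσ : IsSortedRun f g σ T) (hD : ∀ k u, iterDensity f g σ k u ∈ D) {a K κ : ℝ}
    (ha : ∀ t ∈ D, a * (t - 1) ≤ θ t) (hK0 : 0 ≤ K)
    (hK : ∀ k, objective θ (fwIter f σ k, fwIter g σ k) ≤ 4 * K)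
    (hcurv : ∀ k, 1 ≤ k → ∀ u, fwIter g σ (k + 1) u *
        bregman θ θ' (iterDensity f g σ (k + 1) u) (iterDensity f g σ k u) ≤
      (2 / ((k : ℝ) + 2)) ^ 2 * (K * ((permVec f (σ (k + 1)) u - fwIter f σ k u) ^ 2 +
        (permVec g (σ (k + 1)) u - fwIter g σ k u) ^ 2)))
    (hκ0 : 0 < κ)
    (hκ : ∀ u, κ * (iterDensity f g σ T u - ρ u) ^ 2 ≤
      fwIter g σ T u * bregman θ θ' (iterDensity f g σ T u) (ρ u)) :
    ∑ u, (iterDensity f g σ T u - ρ u) ^ 2 ≤ 16 * K / (κ * ((T : ℝ) + 2)) := by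
  obtain ⟨τ, hτ, -⟩ := exists_respects b (Fintype.equivFin V)
  have hy0 : ∀ k u, fwIter g σ k u ≠ 0 := fun k u =>
    (hg0.trans_le (minMarginal_le_fwIter g σ k u)).ne'
  set opt := ∑ u, θ (ρ u) * permVec g τ u with hopt
  -- The minorant `a * (t - 1)` has zero weighted sum because `f` and `g` have the same total. With
  -- `opt ≥ 0`, a bound on the objective is also a bound on the excess.
  have hopt0 : 0 ≤ opt := by
    have h1 : ∑ u, ρ u * permVec g τ u = 1 := by
      have := B.sum_mul_permVec_f I hτ (fun _ => 1)
      simp only [one_mul, sum_permVec I.f_empty, hf1] at this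
      exact this.symm
    calc 0 = ∑ u, a * (ρ u - 1) * permVec g τ u := by
          simp only [mul_assoc, sub_mul, one_mul, ← mul_sum, sum_sub_distrib, h1,
            sum_permVec I.g_empty, hg1, sub_self, mul_zero]
      _ ≤ opt := sum_le_sum fun u _ =>
          mul_le_mul_of_nonneg_right (ha _ (hρ u)) (permVec_nonneg I.g_mono τ u)
  have hrec := le_of_frankWolfe_recursion
    (h := fun k => objective θ (fwIter f σ k, fwIter g σ k) - opt) (T := T) (M := 4 * K)
    (by positivity) (fun k _ => by linarith [hK k]) (fun k hk hkT => by
      have hlin := B.linearized_permVec_le I H hρ hτ (hD k) (hσ k hkT)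
      have hx := fwIter_mem_baseGE I σ k
      have hy := fwIter_mem_baseLE I σ k
      have hs := permVec_mem_feasible I (σ (k + 1))
      have hsum := sum_le_sum fun u (_ : u ∈ univ) => hcurv k hk u
      rw [← mul_sum, ← mul_sum, sum_add_distrib] at hsum
      -- Each squared displacement is at most 2, which is the source of `M = 4 * K`.
      have hsq := add_le_add
        (sum_sub_sq_le_two hx.1 (hx.2.1.trans hf1) hs.1.1 (hs.1.2.1.trans hf1))
        (sum_sub_sq_le_two hy.1 (hy.2.1.trans hg1) hs.2.1 (hs.2.2.1.trans hg1))
      have hsum' := hsum.trans (mul_le_mul_of_nonneg_left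
        (mul_le_mul_of_nonneg_left hsq hK0) (sq_nonneg _))
      -- An exact identity: by homogeneity the linearization at the current iterate returns the
      -- objective there, and the error at the next iterate is the weighted Bregman divergence of
      -- the densities.
      have hid : objective θ (fwIter f σ (k + 1), fwIter g σ (k + 1)) =
          ∑ u, fwIter g σ (k + 1) u *
            bregman θ θ' (iterDensity f g σ (k + 1) u) (iterDensity f g σ k u) +
          (1 - 2 / ((k : ℝ) + 2)) * objective θ (fwIter f σ k, fwIter g σ k) +
          2 / ((k : ℝ) + 2) * (∑ u, θ' (iterDensity f g σ k u) * permVec f (σ (k + 1)) u +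
            ∑ u, (θ (iterDensity f g σ k u) - iterDensity f g σ k u * θ' (iterDensity f g σ k u)) *
              permVec g (σ (k + 1)) u) := by
        simp only [objective]
        rw [← sum_add_distrib, mul_sum, mul_sum, ← sum_add_distrib, ← sum_add_distrib]
        refine sum_congr rfl fun u _ => ?_
        have e1 : fwIter g σ (k + 1) u * iterDensity f g σ (k + 1) u = fwIter f σ (k + 1) u :=
          mul_div_cancel₀ _ (hy0 _ u)
        have e2 : fwIter g σ k u * iterDensity f g σ k u = fwIter f σ k u :=
          mul_div_cancel₀ _ (hy0 _ u)
        have e3 : fwIter f σ (k + 1) u / fwIter g σ (k + 1) u = iterDensity f g σ (k + 1) u := rfl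
        have e4 : fwIter f σ k u / fwIter g σ k u = iterDensity f g σ k u := rfl
        rw [e3, e4]
        have e5 : fwIter f σ (k + 1) u = (1 - 2 / ((k : ℝ) + 2)) * fwIter f σ k u +
          2 / ((k : ℝ) + 2) * permVec f (σ (k + 1)) u := rfl
        have e6 : fwIter g σ (k + 1) u = (1 - 2 / ((k : ℝ) + 2)) * fwIter g σ k u +
          2 / ((k : ℝ) + 2) * permVec g (σ (k + 1)) u := rfl
        rw [← e2] at e5
        simp only [bregman]
        generalize 2 / ((k : ℝ) + 2) = γ at *
        generalize θ' (iterDensity f g σ k u) = t' at *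
        linear_combination t' * (e1 + e5) + (θ (iterDensity f g σ k u) -
          iterDensity f g σ k u * t') * e6
      have hlin' := mul_le_mul_of_nonneg_left hlin (stepSize_mem k).1
      simp only [hid]
      rw [← hopt] at hlin'
      linarith)
  have hfin := B.sum_bregman_le I H hρ hτ (z := (fwIter f σ T, fwIter g σ T))
    ⟨fwIter_mem_baseGE I σ T, fwIter_mem_baseLE I σ T⟩ (hy0 T)
  have hsc := sum_le_sum fun u (_ : u ∈ univ) => hκ u
  rw [← mul_sum] at hsc
  rw [le_div_iff₀ (by positivity), mul_comm κ, ← mul_assoc, mul_right_comm, ← le_div_iff₀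
    (by positivity), mul_comm]
  exact (hsc.trans (hfin.trans hrec)).trans_eq (by ring)

end run
end

/-- Factor `s - r` as a difference of squares and use `(√s + √r) ^ 2 ≤ 2 * (s + r)`, which is at
most `4 / g` when `g > 0`. -/
theorem sq_sub_le_mul_sq_sqrt_sub {g s r : ℝ} (hs : 0 ≤ s) (hr : 0 ≤ r) (hsg : s * g ≤ 1)
    (hrg : r * g ≤ 1) : g / 4 * (s - r) ^ 2 ≤ (√s - √r) ^ 2 := by
  have h1 : s - r = (√s - √r) * (√s + √r) := by
    ring_nf
    rw [Real.sq_sqrt hs, Real.sq_sqrt hr]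
  have h2 : (√s + √r) ^ 2 * g ≤ 4 := by
    rcases le_total g 0 with hg | hg
    · exact (mul_nonpos_of_nonneg_of_nonpos (sq_nonneg _) hg).trans (by norm_num)
    · have : (√s + √r) ^ 2 ≤ 2 * (s + r) := by
        nlinarith [Real.sq_sqrt hs, Real.sq_sqrt hr, sq_nonneg (√s - √r)]
      nlinarith [mul_le_mul_of_nonneg_right this hg]
  rw [h1, mul_pow]
  nlinarith [mul_le_mul_of_nonneg_left h2 (sq_nonneg (√s - √r))]

/-! ### The three divergences -/

theorem bregman_sq (s r : ℝ) : bregman (fun t => t ^ 2) (fun t => 2 * t) s r = (s - r) ^ 2 := by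
  simp only [bregman]
  ring

theorem isConvexDiff_sq : IsConvexDiff (fun t => t ^ 2) (fun t => 2 * t) (Set.Ici 0) where
  nonneg _ hr := hr
  hasDerivAt r _ := by simpa using hasDerivAt_pow 2 r
  mono := fun r _ s _ h => by
    dsimp only
    linarith
  bregman_nonneg s _ r _ := by
    rw [bregman_sq]
    positivity

theorem bregman_mul_log {s r : ℝ} (hs : 0 < s) (hr : 0 < r) :
    bregman (fun t => t * Real.log t) (fun t => Real.log t + 1) s r =
      s * Real.log (s / r) - s + r := by
  simp only [bregman, Real.log_div hs.ne' hr.ne']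
  ring

/-- The relative entropy term is bounded by its chi-square counterpart, through `log t ≤ t - 1` at
`t = s / r`. -/
theorem bregman_mul_log_le {s r : ℝ} (hs : 0 < s) (hr : 0 < r) :
    bregman (fun t => t * Real.log t) (fun t => Real.log t + 1) s r ≤ (s - r) ^ 2 / r := by
  rw [bregman_mul_log hs hr]
  have := mul_le_mul_of_nonneg_left (Real.log_le_sub_one_of_pos (div_pos hs hr)) hs.le
  have e : (s - r) ^ 2 / r = s * (s / r - 1) - s + r := by
    field_simp
    ring
  linarith

/-- Relative entropy dominates the squared Hellinger distance: write `log (s / r)` as `-2 * log (√r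
/ √s)` and apply `log t ≤ t - 1`. -/
theorem sq_sqrt_sub_le_bregman_mul_log {s r : ℝ} (hs : 0 < s) (hr : 0 < r) :
    (√s - √r) ^ 2 ≤ bregman (fun t => t * Real.log t) (fun t => Real.log t + 1) s r := by
  rw [bregman_mul_log hs hr]
  have hs' := Real.sqrt_pos.2 hs
  have hr' := Real.sqrt_pos.2 hr
  have h1 := Real.log_le_sub_one_of_pos (div_pos hr' hs')
  have h2 : Real.log (s / r) = -(2 * Real.log (√r / √s)) := by
    rw [Real.log_div hs.ne' hr.ne', Real.log_div hr'.ne' hs'.ne', Real.log_sqrt hs.le,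
      Real.log_sqrt hr.le]
    ring
  have h3 : s * (√r / √s) = √s * √r := by
    rw [← mul_div_assoc, div_eq_iff hs'.ne', mul_right_comm, Real.mul_self_sqrt hs.le]
  have h4 := mul_le_mul_of_nonneg_left h1 hs.le
  rw [mul_sub, h3, mul_one] at h4
  rw [h2, sub_sq, Real.sq_sqrt hs.le, Real.sq_sqrt hr.le]
  linarith

theorem isConvexDiff_mul_log :
    IsConvexDiff (fun t => t * Real.log t) (fun t => Real.log t + 1) (Set.Ioi 0) where
  nonneg _ hr := le_of_lt hr
  hasDerivAt r hr := Real.hasDerivAt_mul_log (ne_of_gt hr)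
  mono := fun r hr s _ h => by
    dsimp only
    linarith [Real.log_le_log hr h]
  bregman_nonneg s hs r hr := (sq_nonneg _).trans (sq_sqrt_sub_le_bregman_mul_log hs hr)

theorem bregman_neg_log {s r : ℝ} (hs : 0 < s) (hr : 0 < r) :
    bregman (fun t => -Real.log t) (fun t => -t⁻¹) s r = s / r - 1 - Real.log (s / r) := by
  simp only [bregman, Real.log_div hs.ne' hr.ne']
  field_simp
  ring

theorem bregman_neg_log_le {s r : ℝ} (hs : 0 < s) (hr : 0 < r) :
    bregman (fun t => -Real.log t) (fun t => -t⁻¹) s r ≤ (s - r) ^ 2 / (r * s) := by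
  rw [bregman_neg_log hs hr]
  have := Real.log_le_sub_one_of_pos (div_pos hr hs)
  rw [← inv_div, Real.log_inv] at this
  have e : (s - r) ^ 2 / (r * s) = s / r - 1 + ((s / r)⁻¹ - 1) := by
    field_simp
    ring
  linarith

theorem sq_sqrt_sub_le_mul_bregman_neg_log {s r : ℝ} (hs : 0 < s) (hr : 0 < r) :
    (√s - √r) ^ 2 ≤ r * bregman (fun t => -Real.log t) (fun t => -t⁻¹) s r := by
  rw [bregman_neg_log hs hr]
  have hs' := Real.sqrt_pos.2 hs
  have hr' := Real.sqrt_pos.2 hr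
  have h1 := Real.log_le_sub_one_of_pos (div_pos hs' hr')
  have h2 : Real.log (s / r) = 2 * Real.log (√s / √r) := by
    rw [Real.log_div hs.ne' hr.ne', Real.log_div hs'.ne' hr'.ne', Real.log_sqrt hs.le,
      Real.log_sqrt hr.le]
    ring
  have h3 : r * (√s / √r) = √s * √r := by
    rw [← mul_div_assoc, div_eq_iff hr'.ne', mul_assoc, Real.mul_self_sqrt hr.le, mul_comm]
  have h4 := mul_le_mul_of_nonneg_left h1 hr.le
  rw [mul_sub, h3, mul_one] at h4
  rw [h2, sub_sq, Real.sq_sqrt hs.le, Real.sq_sqrt hr.le, mul_sub, mul_sub,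
    mul_div_cancel₀ _ hr.ne']
  linarith

theorem isConvexDiff_neg_log :
    IsConvexDiff (fun t => -Real.log t) (fun t => -t⁻¹) (Set.Ioi 0) where
  nonneg _ hr := le_of_lt hr
  hasDerivAt _ hr := (Real.hasDerivAt_log (ne_of_gt hr)).neg
  mono := fun _ hr _ _ h => neg_le_neg (inv_anti₀ hr h)
  bregman_nonneg _ hs _ hr := nonneg_of_mul_nonneg_right
    ((sq_nonneg _).trans (sq_sqrt_sub_le_mul_bregman_neg_log hs hr)) hr

/-! ### Curvature along a step from `(x, y)` to `(x', y')` -/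

theorem div_sub_div_of_step {x y x' y' a b γ : ℝ} (hy : y ≠ 0) (hy' : y' ≠ 0)
    (ex : x' = x + γ * a) (ey : y' = y + γ * b) :
    x' / y' - x / y = γ * (a * y - x * b) / (y' * y) := by
  rw [div_sub_div _ _ hy' hy, ex, ey]
  ring_nf

theorem curvature_sq {m x y x' y' a b γ : ℝ} (hm : 0 < m) (hm1 : m ≤ 1) (hx : 0 ≤ x)
    (hx1 : x ≤ 1) (hy : m ≤ y) (hy' : m ≤ y') (ex : x' = x + γ * a) (ey : y' = y + γ * b) :
    y' * bregman (fun t => t ^ 2) (fun t => 2 * t) (x' / y') (x / y) ≤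
      γ ^ 2 * (2 / m ^ 3 * (a ^ 2 + b ^ 2)) := by
  have hy0 := hm.trans_le hy
  have hy0' := hm.trans_le hy'
  rw [bregman_sq, div_sub_div_of_step hy0.ne' hy0'.ne' ex ey]
  have e : y' * (γ * (a * y - x * b) / (y' * y)) ^ 2 =
      γ ^ 2 * ((1 / y') * (a - b * (x / y)) ^ 2) := by
    field_simp
  rw [e]
  refine mul_le_mul_of_nonneg_left ?_ (sq_nonneg γ)
  have h1 : x / y ≤ 1 / m := div_le_div₀ zero_le_one hx1 hm hy
  have h2 : 1 ≤ 1 / m := by rwa [le_div_iff₀ hm, one_mul]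
  have h3 : (a - b * (x / y)) ^ 2 ≤ 2 * (1 / m) ^ 2 * (a ^ 2 + b ^ 2) := by
    -- From `(a - b * r) ^ 2 ≤ 2 * a ^ 2 + 2 * b ^ 2 * r ^ 2` with `r ≤ 1 / m`, where `1 ≤ 1 / m`
    -- allows one factor for both terms.
    have h4 : (x / y) ^ 2 ≤ (1 / m) ^ 2 := pow_le_pow_left₀ (by positivity) h1 2
    have h5 : 1 ≤ (1 / m) ^ 2 := one_le_pow₀ h2
    nlinarith [mul_le_mul_of_nonneg_left h4 (sq_nonneg b),
      mul_le_mul_of_nonneg_left h5 (sq_nonneg a), sq_nonneg (a + b * (x / y))]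
  calc 1 / y' * (a - b * (x / y)) ^ 2 ≤ 1 / m * (2 * (1 / m) ^ 2 * (a ^ 2 + b ^ 2)) :=
        mul_le_mul (one_div_le_one_div_of_le hm hy') h3 (sq_nonneg _) (by positivity)
    _ = _ := by
        field_simp

theorem curvature_mul_log {l m x y x' y' a b γ : ℝ} (hl : 0 < l) (hm : 0 < m) (hx : l ≤ x)
    (hx1 : x ≤ 1) (hx' : 0 < x') (hy : m ≤ y) (hy' : m ≤ y') (hyy : y ≤ 3 * y')
    (ex : x' = x + γ * a) (ey : y' = y + γ * b) :
    y' * bregman (fun t => t * Real.log t) (fun t => Real.log t + 1) (x' / y') (x / y) ≤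
      γ ^ 2 * (6 * (1 / m ^ 2 + 1 / l) * (a ^ 2 + b ^ 2)) := by
  have hx0 := hl.trans_le hx
  have hy0 := hm.trans_le hy
  have hy0' := hm.trans_le hy'
  refine (mul_le_mul_of_nonneg_left
    (bregman_mul_log_le (div_pos hx' hy0') (div_pos hx0 hy0)) hy0'.le).trans ?_
  rw [div_sub_div_of_step hy0.ne' hy0'.ne' ex ey]
  have e : y' * ((γ * (a * y - x * b) / (y' * y)) ^ 2 / (x / y)) =
      γ ^ 2 * ((a * y - x * b) ^ 2 / (x * y * y')) := by
    field_simp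
  rw [e]
  refine mul_le_mul_of_nonneg_left ?_ (sq_nonneg γ)
  have h1 : (a * y - x * b) ^ 2 / (x * y * y') ≤
      2 * (a ^ 2 * (y / (x * y')) + b ^ 2 * (x / (y * y'))) := by
    rw [div_le_iff₀ (by positivity)]
    have : 2 * (a ^ 2 * (y / (x * y')) + b ^ 2 * (x / (y * y'))) * (x * y * y') =
        2 * ((a * y) ^ 2 + (x * b) ^ 2) := by
      field_simp
    rw [this]
    nlinarith [sq_nonneg (a * y + x * b)]
  -- Here `y ≤ 3 * y'` keeps a factor `1 / m` out of the bound.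
  have h2 : y / (x * y') ≤ 3 * (1 / l) := by
    rw [div_le_iff₀ (by positivity)]
    have : 1 ≤ 1 / l * x := by
      rw [one_div_mul_eq_div, le_div_iff₀ hl]
      linarith
    nlinarith [mul_le_mul_of_nonneg_right this hy0'.le]
  have h3 : x / (y * y') ≤ 1 / m ^ 2 := by
    rw [sq]
    exact div_le_div₀ zero_le_one hx1 (by positivity) (mul_le_mul hy hy' hm.le hy0.le)
  have h4 := mul_le_mul_of_nonneg_left h2 (sq_nonneg a)
  have h5 := mul_le_mul_of_nonneg_left h3 (sq_nonneg b)
  have h6 : 0 ≤ a ^ 2 * (1 / m ^ 2) := by positivity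
  have h7 : 0 ≤ b ^ 2 * (1 / l) := by positivity
  have h8 : 0 ≤ b ^ 2 * (1 / m ^ 2) := by positivity
  linarith

theorem curvature_neg_log {l m x y x' y' a b γ : ℝ} (hl : 0 < l) (hm : 0 < m) (hx : l ≤ x)
    (hx' : l ≤ x') (hy : m ≤ y) (hy1 : y ≤ 1) (hy' : 0 < y') (hxx : x ≤ 3 * x')
    (ex : x' = x + γ * a) (ey : y' = y + γ * b) :
    y' * bregman (fun t => -Real.log t) (fun t => -t⁻¹) (x' / y') (x / y) ≤
      γ ^ 2 * (6 * (1 / m + 1 / l ^ 2) * (a ^ 2 + b ^ 2)) := by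
  have hx0 := hl.trans_le hx
  have hx0' := hl.trans_le hx'
  have hy0 := hm.trans_le hy
  refine (mul_le_mul_of_nonneg_left
    (bregman_neg_log_le (div_pos hx0' hy') (div_pos hx0 hy0)) hy'.le).trans ?_
  rw [div_sub_div_of_step hy0.ne' hy'.ne' ex ey]
  have e : y' * ((γ * (a * y - x * b) / (y' * y)) ^ 2 / (x / y * (x' / y'))) =
      γ ^ 2 * ((a * y - x * b) ^ 2 / (y * x * x')) := by
    field_simp
  rw [e]
  refine mul_le_mul_of_nonneg_left ?_ (sq_nonneg γ)
  have h1 : (a * y - x * b) ^ 2 / (y * x * x') ≤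
      2 * (a ^ 2 * (y / (x * x')) + b ^ 2 * (x / (y * x'))) := by
    rw [div_le_iff₀ (by positivity)]
    have : 2 * (a ^ 2 * (y / (x * x')) + b ^ 2 * (x / (y * x'))) * (y * x * x') =
        2 * ((a * y) ^ 2 + (x * b) ^ 2) := by
      field_simp
    rw [this]
    nlinarith [sq_nonneg (a * y + x * b)]
  have h2 : x / (y * x') ≤ 3 * (1 / m) := by
    rw [div_le_iff₀ (by positivity)]
    have : 1 ≤ 1 / m * y := by
      rw [one_div_mul_eq_div, le_div_iff₀ hm]
      linarith
    nlinarith [mul_le_mul_of_nonneg_right this hx0'.le]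
  have h3 : y / (x * x') ≤ 1 / l ^ 2 := by
    rw [sq]
    exact div_le_div₀ zero_le_one hy1 (by positivity) (mul_le_mul hx hx' hl.le hx0.le)
  have h4 := mul_le_mul_of_nonneg_left h2 (sq_nonneg b)
  have h5 := mul_le_mul_of_nonneg_left h3 (sq_nonneg a)
  have h6 : 0 ≤ b ^ 2 * (1 / l ^ 2) := by positivity
  have h7 : 0 ≤ a ^ 2 * (1 / m) := by positivity
  have h8 : 0 ≤ a ^ 2 * (1 / l ^ 2) := by positivity
  linarith

/-! ### Rates for the three programs -/

theorem sum_div_eq_one_div {V : Type*} [Fintype V] {x : V → ℝ} {m : ℝ} (hx : ∑ u, x u = 1) : ∑ u, x u / m = 1 / m := by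
  rw [← sum_div, hx]

theorem objective_sq_le {V : Type*} [Fintype V] {x y : V → ℝ} {m : ℝ} (hm : 0 < m) (hx : ∀ u, 0 ≤ x u)
    (hx1 : ∑ u, x u = 1) (hy : ∀ u, m ≤ y u) : objective (fun t => t ^ 2) (x, y) ≤ 1 / m := by
  rw [← sum_div_eq_one_div (m := m) hx1]
  refine sum_le_sum fun u _ => ?_
  have hy0 := hm.trans_le (hy u)
  have e : y u * (x u / y u) ^ 2 = x u * x u / y u := by
    field_simp
  dsimp only
  rw [e]
  exact div_le_div₀ (hx u)
    (mul_le_of_le_one_right (hx u) (le_one_of_sum_eq_one hx hx1 u)) hm (hy u)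

theorem objective_mul_log_le {V : Type*} [Fintype V] {x y : V → ℝ} {m : ℝ} (hm : 0 < m) (hx : ∀ u, 0 < x u)
    (hx1 : ∑ u, x u = 1) (hy : ∀ u, m ≤ y u) :
    objective (fun t => t * Real.log t) (x, y) ≤ 1 / m := by
  rw [← sum_div_eq_one_div (m := m) hx1]
  refine sum_le_sum fun u _ => ?_
  have hy0 := hm.trans_le (hy u)
  have hx0 := hx u
  dsimp only
  rw [← mul_assoc, mul_div_cancel₀ _ hy0.ne', div_eq_mul_one_div (x u) m]
  refine mul_le_mul_of_nonneg_left ?_ hx0.le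
  refine (Real.log_le_sub_one_of_pos (div_pos hx0 hy0)).trans ?_
  have := div_le_div₀ zero_le_one (le_one_of_sum_eq_one (fun v => (hx v).le) hx1 u) hm (hy u)
  linarith

theorem objective_neg_log_le {V : Type*} [Fintype V] {x y : V → ℝ} {l : ℝ} (hl : 0 < l) (hx : ∀ u, l ≤ x u)
    (hy : ∀ u, 0 < y u) (hy1 : ∑ u, y u = 1) :
    objective (fun t => -Real.log t) (x, y) ≤ 1 / l := by
  rw [← sum_div_eq_one_div (m := l) hy1]
  refine sum_le_sum fun u _ => ?_
  have hx0 := hl.trans_le (hx u)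
  have hy0 := hy u
  dsimp only
  rw [← Real.log_inv, inv_div, div_eq_mul_one_div (y u) l]
  refine mul_le_mul_of_nonneg_left ?_ hy0.le
  refine (Real.log_le_sub_one_of_pos (div_pos hy0 hx0)).trans ?_
  have := div_le_div₀ zero_le_one (le_one_of_sum_eq_one (fun v => (hy v).le) hy1 u) hl (hx u)
  linarith

section

variable {V : Type*} [Fintype V] [DecidableEq V] {f g : Finset V → ℝ} {ρ : V → ℝ} {b : V → ℕ}

theorem absError_le {σ : ℕ → Arrangement V} {T : ℕ} {A : ℝ} (hA : 0 ≤ A)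
    (h : ∑ u, (iterDensity f g σ T u - ρ u) ^ 2 ≤ A ^ 2) : absError f g σ T ρ ≤ A := by
  rw [absError, EuclideanSpace.norm_eq]
  refine Real.sqrt_le_iff.2 ⟨hA, ?_⟩
  simpa using h

theorem relError_le {σ : ℕ → Arrangement V} {T : ℕ} {l : ℝ} (hl : 0 < l) {u : V}
    (hρ : l ≤ ρ u) : relError f g σ T ρ u ≤ absError f g σ T ρ / l := by
  rw [relError, abs_div, abs_of_pos (hl.trans_le hρ)]
  refine div_le_div₀ (norm_nonneg _) ?_ hl hρ
  exact PiLp.norm_apply_le (WithLp.toLp 2 (iterDensity f g σ T - ρ)) u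

theorem fwIter_succ_eq_add (h : Finset V → ℝ) (σ : ℕ → Arrangement V) (k : ℕ) (u : V) :
    fwIter h σ (k + 1) u =
      fwIter h σ k u + 2 / ((k : ℝ) + 2) * (permVec h (σ (k + 1)) u - fwIter h σ k u) := by
  rw [fwIter]
  ring

/-- From the second step on the step size is at most `2 / 3`, so a third of the old coordinate
survives. The first step has size one and keeps nothing, hence its exclusion from the curvature
estimate. -/
theorem fwIter_le_three_mul_succ {h : Finset V → ℝ} (hm : Monotone h) (σ : ℕ → Arrangement V)
    {k : ℕ} (hk : 1 ≤ k) {u : V} (h0 : 0 ≤ fwIter h σ k u) :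
    fwIter h σ k u ≤ 3 * fwIter h σ (k + 1) u := by
  have hk' : (1 : ℝ) ≤ k := by exact_mod_cast hk
  have h1 : 2 / ((k : ℝ) + 2) ≤ 2 / 3 := div_le_div_of_nonneg_left (by norm_num) (by norm_num)
    (by linarith)
  have h2 := mul_le_mul_of_nonneg_right h1 h0
  have h3 := mul_nonneg (stepSize_mem k).1 (permVec_nonneg hm (σ (k + 1)) u)
  rw [fwIter]
  linarith

/-! ### Explicit rates for normalized runs -/

/-- An instance with normalized `f`, `g`, the blocks of its density decomposition, and a run of
sorted steps. -/
structure IsNormalizedRun (f g : Finset V → ℝ) (ρ : V → ℝ) (b : V → ℕ)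
    (σ : ℕ → Arrangement V) (T : ℕ) : Prop where
  inst : IsInstance f g
  strict : StrictMono g
  f_univ : f univ = 1
  g_univ : g univ = 1
  blocks : IsBlockIndex f g ρ b
  sorted : IsSortedRun f g σ T

namespace IsNormalizedRun

variable {σ : ℕ → Arrangement V} {T : ℕ}

theorem nonempty (R : IsNormalizedRun f g ρ b σ T) : Nonempty V := by
  by_contra h
  have := not_nonempty_iff.1 h
  have h1 := R.f_univ
  rw [univ_eq_empty, R.inst.f_empty] at h1
  norm_num at h1

theorem g_pos (R : IsNormalizedRun f g ρ b σ T) : 0 < minMarginal g :=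
  have := R.nonempty
  minMarginal_pos R.strict

theorem fw_pos (R : IsNormalizedRun f g ρ b σ T) (k : ℕ) (u : V) : 0 < fwIter g σ k u :=
  R.g_pos.trans_le (minMarginal_le_fwIter g σ k u)

theorem sum_f (R : IsNormalizedRun f g ρ b σ T) (k : ℕ) : ∑ u, fwIter f σ k u = 1 :=
  (fwIter_mem_baseGE R.inst σ k).2.1.trans R.f_univ

theorem sum_g (R : IsNormalizedRun f g ρ b σ T) (k : ℕ) : ∑ u, fwIter g σ k u = 1 :=
  (fwIter_mem_baseLE R.inst σ k).2.1.trans R.g_univ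

theorem f_le_one (R : IsNormalizedRun f g ρ b σ T) (k : ℕ) (u : V) : fwIter f σ k u ≤ 1 :=
  le_one_of_sum_eq_one (fwIter_mem_baseGE R.inst σ k).1 (R.sum_f k) u

theorem g_le_one (R : IsNormalizedRun f g ρ b σ T) (k : ℕ) (u : V) : fwIter g σ k u ≤ 1 :=
  le_one_of_sum_eq_one (fwIter_mem_baseLE R.inst σ k).1 (R.sum_g k) u

theorem minMarginal_f_le_one (R : IsNormalizedRun f g ρ b σ T) : minMarginal f ≤ 1 :=
  have ⟨u⟩ := R.nonempty
  (minMarginal_le_fwIter f σ 0 u).trans (R.f_le_one 0 u)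

theorem minMarginal_g_le_one (R : IsNormalizedRun f g ρ b σ T) : minMarginal g ≤ 1 :=
  have ⟨u⟩ := R.nonempty
  (minMarginal_le_fwIter g σ 0 u).trans (R.g_le_one 0 u)

theorem iterDensity_nonneg (R : IsNormalizedRun f g ρ b σ T) (k : ℕ) (u : V) :
    0 ≤ iterDensity f g σ k u :=
  div_nonneg ((fwIter_mem_baseGE R.inst σ k).1 u) (R.fw_pos k u).le

theorem iterDensity_pos (R : IsNormalizedRun f g ρ b σ T) (hf : 0 < minMarginal f) (k : ℕ)
    (u : V) : 0 < iterDensity f g σ k u :=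
  div_pos (hf.trans_le (minMarginal_le_fwIter f σ k u)) (R.fw_pos k u)

theorem iterDensity_mul_le (R : IsNormalizedRun f g ρ b σ T) (k : ℕ) (u : V) :
    iterDensity f g σ k u * minMarginal g ≤ 1 := by
  rw [iterDensity, div_mul_eq_mul_div, div_le_one (R.fw_pos k u)]
  exact (mul_le_of_le_one_left R.g_pos.le (R.f_le_one k u)).trans (minMarginal_le_fwIter g σ k u)

theorem density_nonneg (R : IsNormalizedRun f g ρ b σ T) (u : V) : 0 ≤ ρ u :=
  (R.blocks.minMarginal_le R.inst R.strict R.g_univ u).2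

theorem minMarginal_le_density (R : IsNormalizedRun f g ρ b σ T) (u : V) : minMarginal f ≤ ρ u :=
  (R.blocks.minMarginal_le R.inst R.strict R.g_univ u).1

theorem density_mul_le (R : IsNormalizedRun f g ρ b σ T) (u : V) : ρ u * minMarginal g ≤ 1 :=
  R.blocks.mul_minMarginal_le_one R.inst R.strict R.f_univ R.g_univ u

theorem sum_sq_le_sq (R : IsNormalizedRun f g ρ b σ T) :
    ∑ u, (iterDensity f g σ T u - ρ u) ^ 2 ≤
      16 * (2 / minMarginal g ^ 3) / (minMarginal g * ((T : ℝ) + 2)) := by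
  have hg := R.g_pos
  have hg1 := R.minMarginal_g_le_one
  refine R.blocks.sum_sq_sub_le R.inst R.f_univ R.g_univ hg isConvexDiff_sq R.density_nonneg
    R.sorted R.iterDensity_nonneg (a := 0) (fun t _ => by simpa using sq_nonneg t) (by positivity)
    (fun k => ?_) (fun k _ u => ?_) hg (fun u => ?_)
  · refine (objective_sq_le hg (fwIter_mem_baseGE R.inst σ k).1 (R.sum_f k)
      (minMarginal_le_fwIter g σ k)).trans ?_
    rw [← mul_div_assoc]
    exact div_le_div₀ (by norm_num) (by norm_num) (by positivity)
      (pow_le_of_le_one hg.le hg1 (by norm_num))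
  · exact curvature_sq hg hg1 ((fwIter_mem_baseGE R.inst σ k).1 u) (R.f_le_one k u)
      (minMarginal_le_fwIter g σ k u) (minMarginal_le_fwIter g σ (k + 1) u)
      (fwIter_succ_eq_add f σ k u) (fwIter_succ_eq_add g σ k u)
  · rw [bregman_sq]
    exact mul_le_mul_of_nonneg_right (minMarginal_le_fwIter g σ T u) (sq_nonneg _)

theorem sum_sq_le_mul_log (R : IsNormalizedRun f g ρ b σ T) (hf : 0 < minMarginal f) :
    ∑ u, (iterDensity f g σ T u - ρ u) ^ 2 ≤
      16 * (6 * (1 / minMarginal g ^ 2 + 1 / minMarginal f)) /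
        (minMarginal g ^ 2 / 4 * ((T : ℝ) + 2)) := by
  have hg := R.g_pos
  have hg1 := R.minMarginal_g_le_one
  have hx : ∀ k u, 0 < fwIter f σ k u := fun k u => hf.trans_le (minMarginal_le_fwIter f σ k u)
  have hρ : ∀ u, 0 < ρ u := fun u => hf.trans_le (R.minMarginal_le_density u)
  refine R.blocks.sum_sq_sub_le R.inst R.f_univ R.g_univ hg isConvexDiff_mul_log hρ
    R.sorted (R.iterDensity_pos hf) (a := 1) (fun t ht => ?_) (by positivity)
    (fun k => ?_) (fun k hk u => ?_) (by positivity) (fun u => ?_)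
  · have ht0 : 0 < t := ht
    have := mul_le_mul_of_nonneg_left (Real.one_sub_inv_le_log_of_pos ht0) ht0.le
    rwa [mul_sub, mul_inv_cancel₀ ht0.ne', mul_one, ← one_mul (t - 1)] at this
  · refine (objective_mul_log_le hg (hx k) (R.sum_f k) (minMarginal_le_fwIter g σ k)).trans ?_
    have h1 : 1 / minMarginal g ≤ 1 / minMarginal g ^ 2 :=
      one_div_le_one_div_of_le (by positivity) (pow_le_of_le_one hg.le hg1 (by norm_num))
    have h2 : 0 < 1 / minMarginal g := by positivity
    have h3 : 0 < 1 / minMarginal f := by positivity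
    linarith
  · exact curvature_mul_log hf hg (minMarginal_le_fwIter f σ k u) (R.f_le_one k u) (hx (k + 1) u)
      (minMarginal_le_fwIter g σ k u) (minMarginal_le_fwIter g σ (k + 1) u)
      (fwIter_le_three_mul_succ R.inst.g_mono σ hk (R.fw_pos k u).le)
      (fwIter_succ_eq_add f σ k u) (fwIter_succ_eq_add g σ k u)
  -- Strong convexity `g_min ^ 2 / 4`: one factor from the square-root comparison, one from the
  -- weight `y ≥ g_min`.
  · have h1 := (sq_sub_le_mul_sq_sqrt_sub (R.iterDensity_nonneg T u) (R.density_nonneg u)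
      (R.iterDensity_mul_le T u) (R.density_mul_le u)).trans
      (sq_sqrt_sub_le_bregman_mul_log (R.iterDensity_pos hf T u) (hρ u))
    have h2 := mul_le_mul (minMarginal_le_fwIter g σ T u) h1 (by positivity) (R.fw_pos T u).le
    exact h2.trans' (le_of_eq (by ring))

theorem sum_sq_le_neg_log (R : IsNormalizedRun f g ρ b σ T) (hf : 0 < minMarginal f) :
    ∑ u, (iterDensity f g σ T u - ρ u) ^ 2 ≤
      16 * (6 * (1 / minMarginal g + 1 / minMarginal f ^ 2)) /
        (minMarginal g ^ 3 / 4 * ((T : ℝ) + 2)) := by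
  have hg := R.g_pos
  have hf1 := R.minMarginal_f_le_one
  have hx : ∀ k u, 0 < fwIter f σ k u := fun k u => hf.trans_le (minMarginal_le_fwIter f σ k u)
  have hρ : ∀ u, 0 < ρ u := fun u => hf.trans_le (R.minMarginal_le_density u)
  refine R.blocks.sum_sq_sub_le R.inst R.f_univ R.g_univ hg isConvexDiff_neg_log hρ
    R.sorted (R.iterDensity_pos hf) (a := -1) (fun t ht => ?_) (by positivity)
    (fun k => ?_) (fun k hk u => ?_) (by positivity) (fun u => ?_)
  · linarith [Real.log_le_sub_one_of_pos (show 0 < t from ht)]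
  · refine (objective_neg_log_le hf (minMarginal_le_fwIter f σ k) (R.fw_pos k)
      (R.sum_g k)).trans ?_
    have h1 : 1 / minMarginal f ≤ 1 / minMarginal f ^ 2 :=
      one_div_le_one_div_of_le (by positivity) (pow_le_of_le_one hf.le hf1 (by norm_num))
    have h2 : 0 < 1 / minMarginal g := by positivity
    have h3 : 0 < 1 / minMarginal f := by positivity
    linarith
  · exact curvature_neg_log hf hg (minMarginal_le_fwIter f σ k u)
      (minMarginal_le_fwIter f σ (k + 1) u) (minMarginal_le_fwIter g σ k u) (R.g_le_one k u)
      (R.fw_pos (k + 1) u) (fwIter_le_three_mul_succ R.inst.f_mono σ hk (hx k u).le)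
      (fwIter_succ_eq_add f σ k u) (fwIter_succ_eq_add g σ k u)
  · have hb := isConvexDiff_neg_log.bregman_nonneg _ (R.iterDensity_pos hf T u) _ (hρ u)
    have h1 := (sq_sub_le_mul_sq_sqrt_sub (R.iterDensity_nonneg T u) (R.density_nonneg u)
      (R.iterDensity_mul_le T u) (R.density_mul_le u)).trans
      (sq_sqrt_sub_le_mul_bregman_neg_log (R.iterDensity_pos hf T u) (hρ u))
    -- The factor `ρ u` in front of the divergence is absorbed by `ρ u * g_min ≤ 1`, at the cost of
    -- a further `g_min`.
    have h2 := mul_le_mul_of_nonneg_left h1 hg.le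
    have h3 := mul_le_mul_of_nonneg_right (R.density_mul_le u) hb
    have h4 : minMarginal g * (minMarginal g / 4 * (iterDensity f g σ T u - ρ u) ^ 2) ≤
        bregman (fun t => -Real.log t) (fun t => -t⁻¹) (iterDensity f g σ T u) (ρ u) := by
      linarith
    have h5 := mul_le_mul (minMarginal_le_fwIter g σ T u) h4 (by positivity) (R.fw_pos T u).le
    exact h5.trans' (le_of_eq (by ring))

theorem absError_le_sq (R : IsNormalizedRun f g ρ b σ T) :
    absError f g σ T ρ ≤ 20 / (minMarginal g ^ (5 / 2 : ℝ) * √((T : ℝ) + 2)) := by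
  have hg := R.g_pos
  have hT : (0 : ℝ) < (T : ℝ) + 2 := by positivity
  -- The argument yields the exponent 2, which is stronger than `5 / 2` since `g_min ≤ 1`.
  have hpow : minMarginal g ^ (5 / 2 : ℝ) ≤ minMarginal g ^ 2 := by
    rw [← Real.rpow_natCast]
    exact Real.rpow_le_rpow_of_exponent_ge hg R.minMarginal_g_le_one (by norm_num)
  have hpow0 : 0 < minMarginal g ^ (5 / 2 : ℝ) := Real.rpow_pos_of_pos hg _
  refine (absError_le (A := 20 / (minMarginal g ^ 2 * √((T : ℝ) + 2))) (by positivity)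
    (R.sum_sq_le_sq.trans ?_)).trans ?_
  · rw [div_pow, mul_pow, Real.sq_sqrt hT.le, ← mul_div_assoc, div_div]
    refine div_le_div₀ (by norm_num) (by norm_num) (by positivity) (le_of_eq (by ring))
  · exact div_le_div_of_nonneg_left (by norm_num) (by positivity)
      (mul_le_mul_of_nonneg_right hpow (Real.sqrt_nonneg _))

theorem absError_le_mul_log (R : IsNormalizedRun f g ρ b σ T) (hf : 0 < minMarginal f) :
    absError f g σ T ρ ≤ 1 / minMarginal g *
      (1 / minMarginal g ^ 2 + 1 / minMarginal f) ^ (1 / 2 : ℝ) * (20 / √((T : ℝ) + 2)) := by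
  have hg := R.g_pos
  have hT : (0 : ℝ) < (T : ℝ) + 2 := by positivity
  refine absError_le (by positivity) ((R.sum_sq_le_mul_log hf).trans ?_)
  rw [← Real.sqrt_eq_rpow, mul_pow, mul_pow, Real.sq_sqrt (by positivity), div_pow 20,
    Real.sq_sqrt hT.le]
  have e : 16 * (6 * (1 / minMarginal g ^ 2 + 1 / minMarginal f)) /
      (minMarginal g ^ 2 / 4 * ((T : ℝ) + 2)) = (1 / minMarginal g) ^ 2 *
        (1 / minMarginal g ^ 2 + 1 / minMarginal f) * (384 / ((T : ℝ) + 2)) := by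
    field_simp
    ring
  rw [e]
  exact mul_le_mul_of_nonneg_left
    (div_le_div_of_nonneg_right (by norm_num) hT.le) (by positivity)

theorem absError_le_neg_log (R : IsNormalizedRun f g ρ b σ T) (hf : 0 < minMarginal f) :
    absError f g σ T ρ ≤ 1 / minMarginal g ^ (3 / 2 : ℝ) *
      (1 / minMarginal g + 1 / minMarginal f ^ 2) ^ (1 / 2 : ℝ) * (20 / √((T : ℝ) + 2)) := by
  have hg := R.g_pos
  have hT : (0 : ℝ) < (T : ℝ) + 2 := by positivity
  have hpow : (minMarginal g ^ (3 / 2 : ℝ)) ^ 2 = minMarginal g ^ 3 := by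
    rw [← Real.rpow_natCast, ← Real.rpow_mul hg.le, ← Real.rpow_natCast]
    norm_num
  refine absError_le (by positivity) ((R.sum_sq_le_neg_log hf).trans ?_)
  rw [← Real.sqrt_eq_rpow, mul_pow, mul_pow, Real.sq_sqrt (by positivity), div_pow 20,
    Real.sq_sqrt hT.le, div_pow, hpow, one_pow]
  have e : 16 * (6 * (1 / minMarginal g + 1 / minMarginal f ^ 2)) /
      (minMarginal g ^ 3 / 4 * ((T : ℝ) + 2)) = 1 / minMarginal g ^ 3 *
        (1 / minMarginal g + 1 / minMarginal f ^ 2) * (384 / ((T : ℝ) + 2)) := by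
    field_simp
    ring
  rw [e]
  exact mul_le_mul_of_nonneg_left
    (div_le_div_of_nonneg_right (by norm_num) hT.le) (by positivity)

end IsNormalizedRun
end

end DualModular

/-! ### Assembly of the bounds -/

open DualModular
theorem theorem5 :
    ∃ C : ℝ, 0 < C ∧
      ∀ (V : Type*) [Fintype V] [DecidableEq V] (f g : Finset V → ℝ),
        IsInstance f g → StrictMono g → f univ = 1 → g univ = 1 →
      ∀ (ρ : V → ℝ), IsDensityVector f g ρ →
      ∀ (T : ℕ) (σ : ℕ → Arrangement V), IsSortedRun f g σ T →
        (fwIter f σ T, fwIter g σ T) ∈ feasible f g ∧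
        -- the function `t ^ 2`
        (IsFrankWolfe (fun t => t ^ 2) f g σ T ∧
          absError f g σ T ρ ≤ C / (minMarginal g ^ (5 / 2 : ℝ) * √((T : ℝ) + 2)) ∧
          (0 < minMarginal f → ∀ u, 0 < ρ u ∧
            relError f g σ T ρ u ≤
              C / (minMarginal f * minMarginal g ^ (5 / 2 : ℝ) * √((T : ℝ) + 2)))) ∧
        -- the function `t * log t`
        (0 < minMarginal f →
          IsFrankWolfe (fun t => t * Real.log t) f g σ T ∧
          absError f g σ T ρ ≤
            1 / (minMarginal f ^ (1 / 2 : ℝ) * minMarginal g) *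
              (1 / minMarginal g ^ 2 + 1 / minMarginal f) ^ (1 / 2 : ℝ) *
              (C / √((T : ℝ) + 2)) ∧
          ∀ u, relError f g σ T ρ u ≤
            1 / (minMarginal f ^ (3 / 2 : ℝ) * minMarginal g) *
              (1 / minMarginal g ^ 2 + 1 / minMarginal f) ^ (1 / 2 : ℝ) *
              (C / √((T : ℝ) + 2))) ∧
        -- the function `- log t`
        (0 < minMarginal f →
          IsFrankWolfe (fun t => -Real.log t) f g σ T ∧
          absError f g σ T ρ ≤
            1 / minMarginal g ^ (3 / 2 : ℝ) *
              (1 / minMarginal g + 1 / minMarginal f ^ 2) ^ (1 / 2 : ℝ) *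
              (C / √((T : ℝ) + 2)) ∧
          ∀ u, relError f g σ T ρ u ≤
            1 / (minMarginal f * minMarginal g ^ (3 / 2 : ℝ)) *
              (1 / minMarginal g + 1 / minMarginal f ^ 2) ^ (1 / 2 : ℝ) *
              (C / √((T : ℝ) + 2))) := by
  -- The logarithmic cases need `C ^ 2 ≥ 16 * 6 * 4 = 384`, and `20 ^ 2 = 400`; the quadratic case
  -- needs only 32.
  refine ⟨20, by norm_num, fun V _ _ f g I hg hf1 hg1 ρ hρ T σ hσ => ?_⟩
  obtain ⟨b, B⟩ := exists_isBlockIndex hg hρ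
  have R : IsNormalizedRun f g ρ b σ T := ⟨I, hg, hf1, hg1, B, hσ⟩
  have hg0 := R.g_pos
  have hrel : 0 < minMarginal f → ∀ u, relError f g σ T ρ u ≤ absError f g σ T ρ / minMarginal f :=
    fun hf u => relError_le hf (R.minMarginal_le_density u)
  -- The bounds for `t * log t` are proved without the extra `f_min ^ (-1 / 2)`; since `f_min ≤ 1`,
  -- inserting it only weakens them.
  have hsqrt : 0 < minMarginal f → minMarginal f ^ (1 / 2 : ℝ) ≤ 1 := fun hf =>
    Real.rpow_le_one hf.le R.minMarginal_f_le_one (by norm_num)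
  refine ⟨⟨fwIter_mem_baseGE I σ T, fwIter_mem_baseLE I σ T⟩,
    ⟨isFrankWolfe_of_isSortedRun I hg0 isConvexDiff_sq hσ R.iterDensity_nonneg,
      R.absError_le_sq, fun hf u => ⟨hf.trans_le (R.minMarginal_le_density u), ?_⟩⟩,
    fun hf => ⟨isFrankWolfe_of_isSortedRun I hg0 isConvexDiff_mul_log hσ (R.iterDensity_pos hf),
      (R.absError_le_mul_log hf).trans ?_, fun u => ?_⟩,
    fun hf => ⟨isFrankWolfe_of_isSortedRun I hg0 isConvexDiff_neg_log hσ (R.iterDensity_pos hf),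
      R.absError_le_neg_log hf, fun u => ?_⟩⟩
  · refine (hrel hf u).trans ((div_le_div_of_nonneg_right R.absError_le_sq hf.le).trans_eq ?_)
    rw [div_div]
    ring_nf
  · refine mul_le_mul_of_nonneg_right (mul_le_mul_of_nonneg_right ?_ (by positivity))
      (by positivity)
    exact one_div_le_one_div_of_le (by positivity) (mul_le_of_le_one_left hg0.le (hsqrt hf))
  · refine (hrel hf u).trans
      ((div_le_div_of_nonneg_right (R.absError_le_mul_log hf) hf.le).trans ?_)
    have h1 : minMarginal f ^ (3 / 2 : ℝ) ≤ minMarginal f := by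
      conv_rhs => rw [← Real.rpow_one (minMarginal f)]
      exact Real.rpow_le_rpow_of_exponent_ge hf R.minMarginal_f_le_one (by norm_num)
    rw [mul_div_right_comm, mul_div_right_comm, div_div, mul_comm (minMarginal g)]
    refine mul_le_mul_of_nonneg_right (mul_le_mul_of_nonneg_right ?_ (by positivity))
      (by positivity)
    exact one_div_le_one_div_of_le (by positivity) (mul_le_mul_of_nonneg_right h1 hg0.le)
  · refine (hrel hf u).trans
      ((div_le_div_of_nonneg_right (R.absError_le_neg_log hf) hf.le).trans_eq ?_)
    rw [mul_div_right_comm, mul_div_right_comm, div_div, mul_comm (minMarginal f)]
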